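/- Let $G$ be a (finite-dimensional) Lie group, $LG=C^\infty(\mathbb T,G)$ its smooth loop group, and $\check G=\mathbb T\ltimes LG$ with product $(\phi_1,\gamma_1)(\phi_2,\gamma_2)=(\phi_1+\phi_2,\gamma_1\rho_{\phi_1}(\gamma_2))$, where $\rho_\phi(\gamma)(\theta)=\gamma(\theta-\phi)$. Let $1\to\mathbb T\to\tilde G\to\check G\to 1$ be any smooth central extension such that $\tilde G\to\check G$ is a principal $\mathbb T$-bundle (for instance the level $k$ extension). Let $Q\to\Sigma$ be a smooth principal $\check G$-bundle over a smooth manifold $\Sigma$, and let $\tilde Q\to Q$ be a lift of $Q$, i.e. a smooth principal $\tilde G$-bundle $\tilde Q\to\Sigma$ with a smooth map $p:\tilde Q\to Q$ over $\Sigma$ that is equivariant along $\tilde G\to\check G$. (Smoothness is understood for diffeological spaces, which include smooth manifolds and Fréchet manifolds as full subcategories; $\Sigma$ may be any diffeological space.) Let $\psi:Q\to Q$ be a gauge transformation, i.e. a $\check G$-equivariant diffeomorphism covering $\mathrm{id}_\Sigma$, and let $g_\psi:Q\to\check G$ be the map with $\psi(q)=q\,g_\psi(q)$. Then $g_\psi$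 is smooth and $g_\psi(qk)=k^{-1}g_\psi(q)k$ for all $q\in Q$, $k\in\check G$. The spaces $\tilde Q\to Q$, $g_\psi^*\tilde G\to Q$ and $\psi^*\tilde Q\to Q$ are principal $\mathbb T$-bundles, where $\mathbb T$ acts through the centre of $\tilde G$, and their associated bundles $(-)\times_{\mathbb T}\mathbb C$ are complex line bundles. Moreover: 1. $\psi^*\tilde Q=\{(q,a)\in Q\times\tilde Q:\psi(q)=p(a)\}$, with $(q,a)k=(q\bar k,ak)$ for $k\in\tilde G$ with image $\bar k\in\check G$, is again a lift of $Q$, and $$\psi^*\tilde Q\;\cong\;\tilde Q\otimes g_\psi^*\tilde G$$ over $Q$, both as principal $\mathbb T$-bundles (with $\otimes$ the quotient of the fibre product by the antidiagonal $\mathbb T$-action) and, after passing to associated bundles, as complex line bundles. 2. A lift of $\psi$ to $\tilde Q$ is the same as a section of $g_\psi^*\tilde G$: there is a bijection $\tilde\psi\leftrightarrow s$ between the $\mathbb T$-equivariant diffeomorphisms $\tilde\psi$ of $\tilde Q$ covering $\psi$ and the smooth sections $s$ of $g_\psi^*\tilde G$, such that $\tilde\psi(a)=a\,s(p(a))$ for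 all $a\in\tilde Q$. Under this bijection $\tilde\psi$ is a gauge transformation of the $\tilde G$-bundle $\tilde Q$ if and only if $s$ is equivariant, i.e. $s(q\bar k)=k^{-1}s(q)k$ for all $q\in Q$ and all $k\in\tilde G$ with image $\bar k\in\check G$. -/

import Mathlib

open scoped Manifold ContDiff TensorProduct Topology
open Diffeology

noncomputable section

/-! ## Smooth structures

Loop groups are infinite dimensional, so smoothness is expressed through Mathlib's diffeological
spaces, which contain finite-dimensional manifolds and Fréchet manifolds as full subcategories.
Openness in a diffeological space always refers to its D-topology. -/

namespace DiffeologicalSpace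

/-- The initial diffeology for a map `f : X → Y`: `p` is a plot iff `f ∘ p` is one. -/
@[reducible]
def induced {X Y : Type*} (f : X → Y) (d : DiffeologicalSpace Y) : DiffeologicalSpace X where
  plots n := {p | IsPlot (f ∘ p)}
  constant_plots x := d.constant_plots (f x)
  plot_reparam hp hf := d.plot_reparam hp hf
  locality {n p} hp := d.locality fun x => by
    obtain ⟨u, hu, hxu, h⟩ := hp x
    exact ⟨u, hu, hxu, fun {m f'} h1 h2 => h h1 h2⟩

/-- The final diffeology for a map `f : X → Y`, generated by the maps `f ∘ p` with `p` a plot. -/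
@[reducible]
def coinduced {X Y : Type*} (f : X → Y) (d : DiffeologicalSpace X) : DiffeologicalSpace Y :=
  generateFrom {σ | ∃ p : EuclideanSpace ℝ (Fin σ.1) → X, IsPlot p ∧ σ.2 = f ∘ p}

instance instProdDiffeology {X Y : Type*} [dX : DiffeologicalSpace X]
    [dY : DiffeologicalSpace Y] : DiffeologicalSpace (X × Y) :=
  induced Prod.fst dX ⊓ induced Prod.snd dY

instance instSubtypeDiffeology {X : Type*} [d : DiffeologicalSpace X] (s : X → Prop) :
    DiffeologicalSpace (Subtype s) :=
  induced Subtype.val d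

instance instQuotDiffeology {X : Type*} [d : DiffeologicalSpace X] (r : X → X → Prop) :
    DiffeologicalSpace (Quot r) :=
  coinduced (Quot.mk r) d

end DiffeologicalSpace

/-- The diffeology of a manifold: the plots are the smooth maps from Euclidean spaces. -/
@[reducible]
def manifoldDiffeology {E H : Type*} [NormedAddCommGroup E] [NormedSpace ℝ E]
    [TopologicalSpace H] (I : ModelWithCorners ℝ E H) (M : Type*) [TopologicalSpace M]
    [ChartedSpace H M] : DiffeologicalSpace M :=
  .ofCorePlotsOn {
    isPlotOn := fun {n u} _ p => ContMDiffOn 𝓘(ℝ, EuclideanSpace ℝ (Fin n)) I ∞ p u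
    isPlotOn_congr := fun _ _ _ h => contMDiffOn_congr h
    isPlot_const := fun _ => contMDiffOn_const
    isPlotOn_reparam := fun _ _ _ h hp hf => hp.comp hf.contMDiffOn h
    locality := fun _ _ h x hx => by
      obtain ⟨v, hv, hxv, hp⟩ := h x hx
      exact ((hp x hxv).contMDiffAt (hv.mem_nhds hxv)).contMDiffWithinAt }

instance instCircleDiffeology : DiffeologicalSpace Circle := manifoldDiffeology (𝓡 1) Circle

/-- A diffeological group (for instance a Fréchet Lie group). -/
class DiffeologicalGroup (K : Type*) [Group K] [DiffeologicalSpace K] : Prop where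
  smooth_mul : DSmooth fun z : K × K => z.1 * z.2
  smooth_inv : DSmooth fun k : K => k⁻¹

/-! ## The loop group and its extension by rotations -/

section LoopGroup

variable (E G : Type*) [NormedAddCommGroup E] [NormedSpace ℝ E] [TopologicalSpace G]
  [ChartedSpace E G] [Group G] [LieGroup 𝓘(ℝ, E) ∞ G]

/-- The loop group `LG` of smooth maps from the circle to `G`, with pointwise multiplication. -/
abbrev LoopGroup : Type _ := C^∞⟮𝓡 1, Circle; 𝓘(ℝ, E), G⟯

/-- The smooth structure of `LG`: a family of loops is smooth iff it is jointly smooth in the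
parameter and in the loop variable. -/
instance instLoopGroupDiffeology : DiffeologicalSpace (LoopGroup E G) :=
  .ofCorePlotsOn {
    isPlotOn := fun {n u} _ p =>
      ContMDiffOn (𝓘(ℝ, EuclideanSpace ℝ (Fin n)).prod (𝓡 1)) 𝓘(ℝ, E) ∞
        (fun z : EuclideanSpace ℝ (Fin n) × Circle => p z.1 z.2) (u ×ˢ Set.univ)
    isPlotOn_congr := fun _ _ _ h => contMDiffOn_congr fun z hz => by rw [h hz.1]
    isPlot_const := fun γ => (γ.contMDiff.comp contMDiff_snd).contMDiffOn
    isPlotOn_reparam := fun _ _ _ h hp hf =>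
      hp.comp ((hf.contMDiffOn.comp contMDiffOn_fst fun _ hz => hz.1).prodMk contMDiffOn_snd)
        fun _ hz => ⟨h hz.1, trivial⟩
    locality := fun _ _ h z hz => by
      obtain ⟨v, hv, hxv, hp⟩ := h z.1 hz.1
      exact ((hp z ⟨hxv, trivial⟩).contMDiffAt
        ((hv.prod isOpen_univ).mem_nhds ⟨hxv, trivial⟩)).contMDiffWithinAt }

/-- Rotation of loops, `(ρ_φ γ)(θ) = γ(θ - φ)` in additive notation. -/
def loopRotation : Circle →* MulAut (LoopGroup E G) where
  toFun φ :=
    { toFun := fun γ => ⟨fun θ => γ (φ⁻¹ * θ), γ.contMDiff.comp contMDiff_mul_left⟩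
      invFun := fun γ => ⟨fun θ => γ (φ * θ), γ.contMDiff.comp contMDiff_mul_left⟩
      left_inv := fun γ => by ext θ; simp [← mul_assoc]
      right_inv := fun γ => by ext θ; simp [← mul_assoc]
      map_mul' := fun γ γ' => by ext θ; rfl }
  map_one' := by
    ext γ θ
    change γ (1⁻¹ * θ) = γ θ
    rw [inv_one, one_mul]
  map_mul' φ φ' := by
    ext γ θ
    change γ ((φ * φ')⁻¹ * θ) = γ (φ'⁻¹ * (φ⁻¹ * θ))
    rw [mul_inv_rev, mul_assoc]

/-- The group `𝕋 ⋉ LG`, with product `(γ₁, φ₁)(γ₂, φ₂) = (γ₁ ρ_{φ₁}(γ₂), φ₁ φ₂)`. -/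
abbrev RotLoopGroup : Type _ := LoopGroup E G ⋊[loopRotation E G] Circle

instance instRotLoopGroupDiffeology : DiffeologicalSpace (RotLoopGroup E G) :=
  .induced (fun a => (a.left, a.right)) inferInstance

instance instRotLoopGroupDiffeologicalGroup : DiffeologicalGroup (RotLoopGroup E G) where
  smooth_mul n p hp := by
    have h2 : ContMDiffOn 𝓘(ℝ, EuclideanSpace ℝ (Fin n)) (𝓡 1) ∞ (fun y => (p y).1.right)
      Set.univ := hp.1.2
    have h3 : ContMDiffOn (𝓘(ℝ, EuclideanSpace ℝ (Fin n)).prod (𝓡 1)) 𝓘(ℝ, E) ∞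
        (fun z : EuclideanSpace ℝ (Fin n) × Circle => (p z.1).1.left z.2)
        (Set.univ ×ˢ Set.univ) := hp.1.1
    have h4 : ContMDiffOn (𝓘(ℝ, EuclideanSpace ℝ (Fin n)).prod (𝓡 1)) 𝓘(ℝ, E) ∞
        (fun z : EuclideanSpace ℝ (Fin n) × Circle => (p z.1).2.left z.2)
        (Set.univ ×ˢ Set.univ) := hp.2.1
    have h5 : ContMDiffOn 𝓘(ℝ, EuclideanSpace ℝ (Fin n)) (𝓡 1) ∞ (fun y => (p y).2.right)
      Set.univ := hp.2.2
    rw [Set.univ_prod_univ, contMDiffOn_univ] at h3 h4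
    rw [contMDiffOn_univ] at h2 h5
    refine ⟨?_, ?_⟩
    · change ContMDiffOn (𝓘(ℝ, EuclideanSpace ℝ (Fin n)).prod (𝓡 1)) 𝓘(ℝ, E) ∞
        (fun z : EuclideanSpace ℝ (Fin n) × Circle =>
          (p z.1).1.left z.2 * (p z.1).2.left ((p z.1).1.right⁻¹ * z.2)) (Set.univ ×ˢ Set.univ)
      exact (h3.mul (h4.comp (contMDiff_fst.prodMk
        (((h2.comp contMDiff_fst).inv).mul contMDiff_snd)))).contMDiffOn
    · change ContMDiffOn 𝓘(ℝ, EuclideanSpace ℝ (Fin n)) (𝓡 1) ∞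
        (fun y => (p y).1.right * (p y).2.right) Set.univ
      exact (h2.mul h5).contMDiffOn
  smooth_inv n p hp := by
    have h2 : ContMDiffOn 𝓘(ℝ, EuclideanSpace ℝ (Fin n)) (𝓡 1) ∞ (fun y => (p y).right)
      Set.univ := hp.2
    have h3 : ContMDiffOn (𝓘(ℝ, EuclideanSpace ℝ (Fin n)).prod (𝓡 1)) 𝓘(ℝ, E) ∞
        (fun z : EuclideanSpace ℝ (Fin n) × Circle => (p z.1).left z.2)
        (Set.univ ×ˢ Set.univ) := hp.1
    rw [Set.univ_prod_univ, contMDiffOn_univ] at h3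
    rw [contMDiffOn_univ] at h2
    refine ⟨?_, ?_⟩
    · change ContMDiffOn (𝓘(ℝ, EuclideanSpace ℝ (Fin n)).prod (𝓡 1)) 𝓘(ℝ, E) ∞
        (fun z : EuclideanSpace ℝ (Fin n) × Circle =>
          ((p z.1).left ((p z.1).right⁻¹⁻¹ * z.2))⁻¹) (Set.univ ×ˢ Set.univ)
      exact (h3.comp (contMDiff_fst.prodMk
        (((h2.comp contMDiff_fst).inv.inv).mul contMDiff_snd))).inv.contMDiffOn
    · change ContMDiffOn 𝓘(ℝ, EuclideanSpace ℝ (Fin n)) (𝓡 1) ∞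
        (fun y => (p y).right⁻¹) Set.univ
      exact h2.inv.contMDiffOn

end LoopGroup

/-! ## Principal bundles -/

universe u v w w'

/-- A space over `X` with a fibrewise right action of the group `K`. -/
structure RightSpace (K : Type u) [Group K] (X : Type v) where
  Carrier : Type w
  [diffeology : DiffeologicalSpace Carrier]
  proj : Carrier → X
  act : Carrier → K → Carrier
  act_one : ∀ p, act p 1 = p
  act_mul : ∀ p k k', act p (k * k') = act (act p k) k'
  proj_act : ∀ p k, proj (act p k) = proj p

attribute [instance] RightSpace.diffeology

namespace RightSpace

variable {K : Type u} [Group K] {X : Type v}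

/-- `P` is a smooth principal `K`-bundle over `X`: the projection and the action are smooth, and
`P` is locally, over open sets `U` of the base, equivariantly diffeomorphic to `U × K`. -/
structure IsPrincipal [DiffeologicalSpace K] [DiffeologicalSpace X] (P : RightSpace.{u, v, w} K X) :
    Prop where
  smooth_proj : DSmooth P.proj
  smooth_act : DSmooth fun z : P.Carrier × K => P.act z.1 z.2
  locally_trivial : ∀ x : X, ∃ U : Set X, IsOpen[dTopology] U ∧ x ∈ U ∧
    ∃ φ : (U × K) ≃ {p : P.Carrier // P.proj p ∈ U}, DSmooth φ ∧ DSmooth φ.symm ∧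
      ∀ (y : U) (k k' : K), P.proj (φ (y, k)).1 = y ∧
        (φ (y, k * k')).1 = P.act (φ (y, k)).1 k'

/-- Isomorphisms of principal `K`-bundles over `X` (covering the identity). -/
structure Iso (P : RightSpace.{u, v, w} K X) (P' : RightSpace.{u, v, w'} K X) where
  toEquiv : P.Carrier ≃ P'.Carrier
  smooth : DSmooth toEquiv
  smooth_symm : DSmooth toEquiv.symm
  proj_apply : ∀ p, P'.proj (toEquiv p) = P.proj p
  map_act : ∀ p k, toEquiv (P.act p k) = P'.act (toEquiv p) k

/-- Gauge transformations of `P`: its automorphisms covering the identity of the base. -/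
abbrev Gauge (P : RightSpace.{u, v, w} K X) := P.Iso P

/-- Smooth sections. -/
structure SmoothSection [DiffeologicalSpace X] (P : RightSpace.{u, v, w} K X) where
  toFun : X → P.Carrier
  smooth : DSmooth toFun
  proj_apply : ∀ x, P.proj (toFun x) = x

/-- The pullback `f^* P`, with total space the fibre product. -/
def pullback {Y : Type w'} [DiffeologicalSpace Y] (P : RightSpace.{u, v, w} K X) (f : Y → X) :
    RightSpace K Y where
  Carrier := {z : Y × P.Carrier // f z.1 = P.proj z.2}
  proj z := z.1.1
  act z k := ⟨(z.1.1, P.act z.1.2 k), by rw [P.proj_act]; exact z.2⟩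
  act_one z := by simp [P.act_one]
  act_mul z k k' := by simp [P.act_mul]
  proj_act _ _ := rfl

namespace IsPrincipal

variable [DiffeologicalSpace K] [DiffeologicalSpace X] {P : RightSpace.{u, v, w} K X}

/-- Two points of a fibre differ by an element of the group. -/
lemma exists_act (h : P.IsPrincipal) {p p' : P.Carrier} (hp : P.proj p' = P.proj p) :
    ∃ k, p' = P.act p k := by
  obtain ⟨U, -, hxU, φ, -, -, hφ⟩ := h.locally_trivial (P.proj p)
  obtain ⟨⟨y, k⟩, hk⟩ := φ.surjective ⟨p, hxU⟩
  obtain ⟨⟨y', k'⟩, hk'⟩ := φ.surjective ⟨p', hp ▸ hxU⟩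
  have hk1 : (φ (y, k)).1 = p := by rw [hk]
  have hk1' : (φ (y', k')).1 = p' := by rw [hk']
  have hy : y' = y := Subtype.ext <| by
    rw [← (hφ y' k' 1).1, ← (hφ y k 1).1, hk1, hk1', hp]
  subst hy
  refine ⟨k⁻¹ * k', ?_⟩
  rw [← hk1, ← hk1', ← (hφ _ _ _).2, mul_inv_cancel_left]

/-- The map `g_ψ : P → K` that represents a gauge transformation `ψ`: `ψ(p) = p · g_ψ(p)`. -/
def gaugeMap (h : P.IsPrincipal) (ψ : P.Gauge) (p : P.Carrier) : K :=
  (h.exists_act (ψ.proj_apply p)).choose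

lemma act_gaugeMap (h : P.IsPrincipal) (ψ : P.Gauge) (p : P.Carrier) :
    ψ.toEquiv p = P.act p (h.gaugeMap ψ p) :=
  (h.exists_act (ψ.proj_apply p)).choose_spec

end IsPrincipal

/-! ### Circle bundles and line bundles -/

/-- The tensor product of circle bundles: the quotient of `P ×_X P'` by the antidiagonal circle
action, so that `p t ⊗ p' = p ⊗ p' t`. -/
def tensor (P : RightSpace.{0, v, w} Circle X) (P' : RightSpace.{0, v, w'} Circle X) :
    RightSpace Circle X where
  Carrier := Quot fun z z' : {z : P.Carrier × P'.Carrier // P.proj z.1 = P'.proj z.2} =>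
    ∃ t : Circle, z'.1.1 = P.act z.1.1 t ∧ z'.1.2 = P'.act z.1.2 t⁻¹
  proj := Quot.lift (fun z => P.proj z.1.1) fun z z' ⟨t, h, _⟩ => by rw [h, P.proj_act]
  act c s := Quot.map
    (fun z => ⟨(P.act z.1.1 s, z.1.2), by rw [P.proj_act]; exact z.2⟩)
    (fun z z' ⟨t, h, h'⟩ => ⟨t, by simp only [h, ← P.act_mul, mul_comm], h'⟩) c
  act_one c := by
    induction c using Quot.ind with
    | mk z => simp [Quot.map, P.act_one]
  act_mul c s s' := by
    induction c using Quot.ind with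
    | mk z => simp [Quot.map, P.act_mul]
  proj_act c s := by
    induction c using Quot.ind with
    | mk z => exact P.proj_act _ _

end RightSpace

/-- A family of complex vector spaces over `X`, with a smooth structure on its total space. -/
structure LineFamily (X : Type v) where
  Fiber : X → Type w
  [addCommGroup : ∀ x, AddCommGroup (Fiber x)]
  [module : ∀ x, Module ℂ (Fiber x)]
  [diffeology : DiffeologicalSpace (Σ x, Fiber x)]

attribute [instance] LineFamily.addCommGroup LineFamily.module LineFamily.diffeology

instance instComplexDiffeology : DiffeologicalSpace ℂ := NormedSpace.toDiffeology ℂ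

namespace LineFamily

variable {X : Type v}

/-- `L` is a smooth complex line bundle: it is locally isomorphic to `U × ℂ`. -/
structure IsLineBundle [DiffeologicalSpace X] (L : LineFamily.{v, w} X) : Prop where
  smooth_proj : DSmooth fun a : Σ x, L.Fiber x => a.1
  locally_trivial : ∀ x : X, ∃ U : Set X, IsOpen[dTopology] U ∧ x ∈ U ∧
    ∃ e : ∀ y : U, ℂ ≃ₗ[ℂ] L.Fiber y,
      DSmooth (fun z : U × ℂ => (⟨z.1, e z.1 z.2⟩ : Σ x, L.Fiber x)) ∧
      DSmooth (fun a : {a : Σ x, L.Fiber x // a.1 ∈ U} => (e ⟨a.1.1, a.2⟩).symm a.1.2)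

/-- Isomorphisms of line bundles over `X`. -/
structure Iso (L : LineFamily.{v, w} X) (L' : LineFamily.{v, w'} X) where
  equiv : ∀ x, L.Fiber x ≃ₗ[ℂ] L'.Fiber x
  smooth : DSmooth fun a : Σ x, L.Fiber x => (⟨a.1, equiv a.1 a.2⟩ : Σ x, L'.Fiber x)
  smooth_symm : DSmooth fun a : Σ x, L'.Fiber x => (⟨a.1, (equiv a.1).symm a.2⟩ : Σ x, L.Fiber x)

/-- The tensor product of line bundles over `X`. Since the fibres are lines, its smooth structure is
generated by the families `a ⊗ b` with `a`, `b` smooth. -/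
def tensor [DiffeologicalSpace X] (L : LineFamily.{v, w} X) (L' : LineFamily.{v, w'} X) :
    LineFamily X where
  Fiber x := L.Fiber x ⊗[ℂ] L'.Fiber x
  diffeology := .coinduced
    (fun z : {z : (Σ x, L.Fiber x) × (Σ x, L'.Fiber x) // z.1.1 = z.2.1} =>
      ⟨z.1.2.1, (z.2 ▸ z.1.1.2) ⊗ₜ[ℂ] z.1.2.2⟩) inferInstance

end LineFamily

/-- The complex line bundle `P ×_𝕋 ℂ` associated to a circle bundle `P`. Its fibre at `x` consists of
the functions `f : P_x → ℂ` with `f(p t) = t⁻¹ f(p)`; the function with `f(p) = z` is the class of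
`(p, z)`. A family of such functions is smooth if locally its values along a smooth family of
points of `P` are smooth. -/
def RightSpace.line {X : Type v} (P : RightSpace.{0, v, w} Circle X) [DiffeologicalSpace X] :
    LineFamily.{v, w} X where
  Fiber x :=
    ({carrier := {f | ∀ (p : {p : P.Carrier // P.proj p = x}) (t : Circle),
        f ⟨P.act p.1 t, by rw [P.proj_act]; exact p.2⟩ = (t : ℂ)⁻¹ * f p}
      add_mem' := fun hf hg p t => by simp [hf p t, hg p t, mul_add]
      zero_mem' := fun p t => by simp
      smul_mem' := fun c f hf p t => by simp [hf p t, mul_left_comm]} :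
      Submodule ℂ ({p : P.Carrier // P.proj p = x} → ℂ))
  diffeology := .generateFrom {σ | ∃ (p : EuclideanSpace ℝ (Fin σ.1) → P.Carrier)
    (hp : ∀ y, P.proj (p y) = (σ.2 y).1), IsPlot p ∧
      ContDiff ℝ ∞ fun y => (σ.2 y).2.1 ⟨p y, hp y⟩}

/-! ## Central extensions and lifts -/

/-- A smooth central extension `1 → 𝕋 → K' → K → 1`, where `K' → K` is a principal
circle bundle. -/
structure CentralExtension (K : Type u) [Group K] [DiffeologicalSpace K]
    (K' : Type v) [Group K'] [DiffeologicalSpace K'] where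
  incl : Circle →* K'
  proj : K' →* K
  incl_injective : Function.Injective incl
  proj_surjective : Function.Surjective proj
  range_incl : incl.range = proj.ker
  central : incl.range ≤ Subgroup.center K'
  principal : RightSpace.IsPrincipal (K := Circle) (X := K)
    { Carrier := K'
      proj := proj
      act := fun k t => k * incl t
      act_one := fun k => by simp
      act_mul := fun k t t' => by simp [mul_assoc]
      proj_act := fun k t => by
        have : incl t ∈ proj.ker := range_incl ▸ ⟨t, rfl⟩
        rw [map_mul, MonoidHom.mem_ker.1 this, mul_one] }

namespace CentralExtension

variable {K : Type u} [Group K] [DiffeologicalSpace K] {K' : Type v} [Group K']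
  [DiffeologicalSpace K'] (ext : CentralExtension K K')

lemma proj_incl (t : Circle) : ext.proj (ext.incl t) = 1 :=
  MonoidHom.mem_ker.1 (ext.range_incl ▸ ⟨t, rfl⟩)

/-- The extension `K'` as a circle bundle over `K`. -/
def circleBundle : RightSpace Circle K where
  Carrier := K'
  proj := ext.proj
  act k t := k * ext.incl t
  act_one k := by simp
  act_mul k t t' := by simp [mul_assoc]
  proj_act k t := by rw [map_mul, ext.proj_incl, mul_one]

variable {B : Type w}

/-- `P`, with the map `p : P → Q`, is a lift of the principal `K`-bundle `Q` to a principal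
`K'`-bundle over the same base. -/
structure IsLift [DiffeologicalSpace B] (Q : RightSpace.{u, w, w'} K B) (P : RightSpace K' B)
    (p : P.Carrier → Q.Carrier) : Prop where
  principal : P.IsPrincipal
  smooth : DSmooth p
  proj_apply : ∀ a, Q.proj (p a) = P.proj a
  map_act : ∀ a k, p (P.act a k) = Q.act (p a) (ext.proj k)

/-- A lift `P` of `Q`, regarded as a circle bundle over `Q` by means of the central circle. -/
def overTotal [DiffeologicalSpace B] {Q : RightSpace.{u, w, w'} K B} {P : RightSpace K' B}
    {p : P.Carrier → Q.Carrier} (h : ext.IsLift Q P p) : RightSpace Circle Q.Carrier where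
  Carrier := P.Carrier
  proj := p
  act a t := P.act a (ext.incl t)
  act_one a := by rw [map_one, P.act_one]
  act_mul a t t' := by rw [map_mul, P.act_mul]
  proj_act a t := by rw [h.map_act, ext.proj_incl, Q.act_one]

/-- The `K'`-action on `ψ^* P = {(q, a) | ψ(q) = p(a)}` for a gauge transformation `ψ` of `Q`. As a
space over `Q` this is the pullback of `P → Q` along `ψ`. -/
def gaugePullback [DiffeologicalSpace B] {Q : RightSpace.{u, w, w'} K B} {P : RightSpace K' B}
    {p : P.Carrier → Q.Carrier} (h : ext.IsLift Q P p) (ψ : Q.Gauge) : RightSpace K' B where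
  Carrier := {z : Q.Carrier × P.Carrier // ψ.toEquiv z.1 = p z.2}
  proj z := Q.proj z.1.1
  act z k := ⟨(Q.act z.1.1 (ext.proj k), P.act z.1.2 k), by rw [ψ.map_act, h.map_act, z.2]⟩
  act_one z := Subtype.ext <| Prod.ext (by simp [Q.act_one]) (P.act_one _)
  act_mul z k k' := Subtype.ext <| Prod.ext (by simp [Q.act_mul]) (P.act_mul _ _ _)
  proj_act z k := Q.proj_act _ _

/-- The value in `K'` of a section of `g^* K' = {(y, k) | g(y) = [k]}`. -/
def sectionValue {Y : Type w} [DiffeologicalSpace Y] {g : Y → K}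
    (s : (ext.circleBundle.pullback g).SmoothSection) (y : Y) : K' :=
  (s.toFun y).1.2

/-- A lift of a gauge transformation `ψ` of `Q` to a lift `P` of `Q` as a circle bundle over `Q`:
a circle-equivariant diffeomorphism of `P` that covers `ψ`. -/
structure GaugeLift [DiffeologicalSpace B] {Q : RightSpace.{u, w, w'} K B} {P : RightSpace K' B}
    {p : P.Carrier → Q.Carrier} (h : ext.IsLift Q P p) (ψ : Q.Gauge) where
  toEquiv : P.Carrier ≃ P.Carrier
  smooth : DSmooth toEquiv
  smooth_symm : DSmooth toEquiv.symm
  covers : ∀ a, p (toEquiv a) = ψ.toEquiv (p a)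
  map_act : ∀ a t, toEquiv ((ext.overTotal h).act a t) = (ext.overTotal h).act (toEquiv a) t

end CentralExtension

end

/-! Everything rests on the torsor property: two points in a fibre of a principal bundle differ by a
unique group element, which depends smoothly on them (`RightSpace.IsPrincipal.dSmooth_div`).
Conversely, smooth division and smooth local sections give local triviality
(`RightSpace.isPrincipal_of_localSections`); the pullbacks and `P → Q` are recognised as principal
bundles in this way.

If `p a = p b`, then `b = a k` with `k` over `1`, so `k` lies in the central circle. Hence `P → Q`
is a circle bundle, with local sections built from those of `P → B` and `K' → K`
(`isPrincipal_overTotal`).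

Since `ψ(q) = q g_ψ(q)`, a point `a` over `q` and an element `k` over `g_ψ(q)` give a point `a k`
over `ψ(q)`. The map `(a, (q, k)) ↦ (q, a k)` from `P ×_Q g_ψ^* K'` to `ψ^* P` is circle-equivariant
in each variable because the circle is central. A biequivariant map descends to an equivariant map
of circle torsors `P ⊗ R → S`, which is an isomorphism (`nonempty_iso_tensor`). For the line
bundles, evaluation at `a`, `b` and `m(a, b)` identifies the three fibres with `ℂ`; the resulting
isomorphism is independent of `a` and `b` because the scalars cancel (`nonempty_line_iso_tensor`).

A lift `χ` of `ψ` has the form `χ(a) = a k` with `k` unique. As `χ` commutes with the central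
circle, `k` depends only on `p a`, so it is a section `s` of `g_ψ^* K'`; conversely `a ↦ a s(p(a))`
is a lift (`gaugeLiftEquiv`). Comparing `χ(a k)` with `χ(a) k` and cancelling `a` gives the
equivariance criterion. -/

/-! ## Smooth maps between diffeological spaces -/

namespace Diffeology

variable {X Y Z : Type*} [DiffeologicalSpace X] [DiffeologicalSpace Y] [DiffeologicalSpace Z]

theorem DSmooth.fst {f : X → Y × Z} (hf : DSmooth f) : DSmooth fun x => (f x).1 :=
  fun n p hp => (hf n p hp).1

theorem DSmooth.snd {f : X → Y × Z} (hf : DSmooth f) : DSmooth fun x => (f x).2 :=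
  fun n p hp => (hf n p hp).2

theorem DSmooth.prodMk {f : X → Y} {g : X → Z} (hf : DSmooth f) (hg : DSmooth g) :
    DSmooth fun x => (f x, g x) :=
  fun n p hp => ⟨hf n p hp, hg n p hp⟩

theorem DSmooth.subtypeVal {s : Y → Prop} {f : X → Subtype s} (hf : DSmooth f) :
    DSmooth fun x => (f x).1 :=
  fun n p hp => hf n p hp

theorem dSmooth_subtypeVal {s : X → Prop} : DSmooth (Subtype.val : Subtype s → X) :=
  fun _ _ hp => hp

theorem DSmooth.subtypeMk {s : Y → Prop} {f : X → Y} (hf : DSmooth f) (hs : ∀ x, s (f x)) :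
    DSmooth fun x => (⟨f x, hs x⟩ : Subtype s) :=
  fun n p hp => hf n p hp

/-- A map out of a space with a generated diffeology is smooth if it maps generators to plots. -/
theorem dSmooth_generateFrom {X Y : Type*} [dY : DiffeologicalSpace Y]
    {g : Set ((n : ℕ) × (EuclideanSpace ℝ (Fin n) → X))} {f : X → Y}
    (h : ∀ (n : ℕ) (p : EuclideanSpace ℝ (Fin n) → X), ⟨n, p⟩ ∈ g → IsPlot (f ∘ p)) :
    @DSmooth X Y (.generateFrom g) dY f := by
  intro n p hp
  -- A plot of the generated diffeology is a plot of every diffeology containing the generators; it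
  -- is tested here against the initial diffeology of `f`.
  exact hp (.induced f dY) fun σ hσ => h σ.1 σ.2 hσ

/-- A map out of a space with a final diffeology is smooth if its composite is. -/
theorem dSmooth_coinduced {X Y Z : Type*} [dX : DiffeologicalSpace X] [dZ : DiffeologicalSpace Z]
    {f : X → Y} {g : Y → Z} (h : DSmooth (g ∘ f)) :
    @DSmooth Y Z (.coinduced f dX) dZ g := by
  refine dSmooth_generateFrom fun n p hp => ?_
  obtain ⟨r, hr, hpr⟩ := hp
  have hp' : g ∘ p = (g ∘ f) ∘ r := congrArg (g ∘ ·) hpr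
  exact hp' ▸ h n r hr

theorem dSmooth_into_coinduced {X Y : Type*} [dX : DiffeologicalSpace X] (f : X → Y) :
    @DSmooth X Y dX (.coinduced f dX) f :=
  fun _ p hp => DiffeologicalSpace.isPlot_generatedFrom_of_mem
    (g := {σ | ∃ p : EuclideanSpace ℝ (Fin σ.1) → X, IsPlot p ∧ σ.2 = f ∘ p}) ⟨p, hp, rfl⟩

/-- Smoothness is local for the D-topology. -/
theorem dSmooth_of_locally {f : X → Y}
    (h : ∀ x, ∃ U : Set X, IsOpen[dTopology] U ∧ x ∈ U ∧ DSmooth fun y : U => f y) :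
    DSmooth f := by
  intro n p hp
  refine DiffeologicalSpace.locality fun x => ?_
  obtain ⟨U, hU, hx, hf⟩ := h (p x)
  refine ⟨p ⁻¹' U, isOpen_iff_preimages_plots.1 hU n p hp, hx, fun {m r} hr hr' => ?_⟩
  exact hf m (fun y => ⟨p (r y), hr y⟩) (isPlot_reparam hp hr')

theorem DSmooth.isOpen_preimage {f : X → Y} (hf : DSmooth f) {U : Set Y}
    (hU : IsOpen[dTopology] U) : IsOpen[dTopology] (f ⁻¹' U) :=
  isOpen_iff_preimages_plots.2 fun n p hp => isOpen_iff_preimages_plots.1 hU n _ (hf n p hp)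

theorem isOpen_inter {U V : Set X} (hU : IsOpen[dTopology] U) (hV : IsOpen[dTopology] V) :
    IsOpen[dTopology] (U ∩ V) :=
  isOpen_iff_preimages_plots.2 fun n p hp =>
    (isOpen_iff_preimages_plots.1 hU n p hp).inter (isOpen_iff_preimages_plots.1 hV n p hp)

/-- Preimages of open sets under smooth maps defined on an open subset are open. -/
theorem isOpen_image_val_preimage {U : Set X} (hU : IsOpen[dTopology] U) {f : U → Y}
    (hf : DSmooth f) {W : Set Y} (hW : IsOpen[dTopology] W) :
    IsOpen[dTopology] (Subtype.val '' (f ⁻¹' W)) := by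
  refine isOpen_iff_preimages_plots.2 fun n p hp => isOpen_iff_mem_nhds.2 ?_
  rintro x ⟨⟨_, hx⟩, hxW, rfl⟩
  obtain ⟨ε, hε, hball⟩ := Metric.isOpen_iff.1 (isOpen_iff_preimages_plots.1 hU n p hp) x hx
  -- Plots are defined on all of Euclidean space, while `f` makes sense only on a ball around `x`;
  -- the smooth map `e` reparametrises that ball by the whole space.
  let e := OpenPartialHomeomorph.univBall x ε
  have he : ∀ y, e y ∈ Metric.ball x ε := fun y => by
    rw [← OpenPartialHomeomorph.univBall_target x hε]
    exact e.map_source (by simp [e])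
  have hop : IsOpen ((fun y => f ⟨p (e y), hball (he y)⟩) ⁻¹' W) :=
    isOpen_iff_preimages_plots.1 hW n _ (hf n (fun y => ⟨p (e y), hball (he y)⟩)
      (isPlot_reparam hp OpenPartialHomeomorph.contDiff_univBall))
  have hop' := e.isOpen_image_of_subset_source hop (by simp [e])
  refine Filter.mem_of_superset (hop'.mem_nhds ⟨0, ?_, ?_⟩) ?_
  · have : e 0 = x := by simp [e]
    simpa [this] using hxW
  · simp [e]
  · rintro _ ⟨y, hy, rfl⟩
    exact ⟨_, hy, rfl⟩

end Diffeology

/-! ### Diffeological groups and the circle -/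

namespace DiffeologicalGroup

variable {K X : Type*} [Group K] [DiffeologicalSpace K] [DiffeologicalGroup K]
  [DiffeologicalSpace X]

theorem dSmooth_mul {f g : X → K} (hf : DSmooth f) (hg : DSmooth g) :
    DSmooth fun x => f x * g x :=
  (smooth_mul (K := K)).comp (hf.prodMk hg)

theorem dSmooth_inv {f : X → K} (hf : DSmooth f) : DSmooth fun x => (f x)⁻¹ :=
  (smooth_inv (K := K)).comp hf

end DiffeologicalGroup

theorem Circle.isPlot_iff {n : ℕ} {p : EuclideanSpace ℝ (Fin n) → Circle} :
    IsPlot p ↔ ContMDiff 𝓘(ℝ, EuclideanSpace ℝ (Fin n)) (𝓡 1) ∞ p :=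
  contMDiffOn_univ

instance Circle.instDiffeologicalGroup : DiffeologicalGroup Circle where
  smooth_mul _ _ hp :=
    Circle.isPlot_iff.2 ((Circle.isPlot_iff.1 hp.1).mul (Circle.isPlot_iff.1 hp.2))
  smooth_inv _ _ hp := Circle.isPlot_iff.2 (Circle.isPlot_iff.1 hp).inv

theorem Circle.dSmooth_coe : DSmooth fun z : Circle => (z : ℂ) := fun _ _ hp =>
  haveI : Fact (Module.finrank ℝ ℂ = 1 + 1) := finrank_real_complex_fact'
  ((contMDiff_coe_sphere (n := 1) (E := ℂ)).comp (Circle.isPlot_iff.1 hp)).contDiff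

theorem Complex.dSmooth_mul {X : Type*} [DiffeologicalSpace X] {f g : X → ℂ} (hf : DSmooth f)
    (hg : DSmooth g) : DSmooth fun x => f x * g x :=
  fun n p hp => ContDiff.mul (show ContDiff ℝ ∞ (f ∘ p) from hf n p hp)
    (show ContDiff ℝ ∞ (g ∘ p) from hg n p hp)

/-! ## Principal bundles -/

namespace RightSpace

variable {K : Type*} [Group K] [DiffeologicalSpace K] {X : Type*} [DiffeologicalSpace X]
  {P : RightSpace K X}

/-- A smooth free action that is transitive on the fibres, with smooth division and smooth local
sections, defines a principal bundle. -/
theorem isPrincipal_of_localSections (smooth_proj : DSmooth P.proj)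
    (smooth_act : DSmooth fun z : P.Carrier × K => P.act z.1 z.2)
    (localSections : ∀ x : X, ∃ U : Set X, IsOpen[dTopology] U ∧ x ∈ U ∧
      ∃ s : U → P.Carrier, DSmooth s ∧ ∀ y, P.proj (s y) = y)
    (transitive : ∀ a b, P.proj b = P.proj a → ∃ k, b = P.act a k)
    (free : ∀ a, Function.Injective (P.act a))
    (smooth_div : ∀ (n : ℕ) (a b : EuclideanSpace ℝ (Fin n) → P.Carrier)
      (k : EuclideanSpace ℝ (Fin n) → K), IsPlot a → IsPlot b →
      (∀ y, b y = P.act (a y) (k y)) → IsPlot k) : P.IsPrincipal where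
  smooth_proj := smooth_proj
  smooth_act := smooth_act
  locally_trivial x := by
    obtain ⟨U, hU, hx, s, hs, hsp⟩ := localSections x
    have ex : ∀ a : {a : P.Carrier // P.proj a ∈ U}, ∃ k, a.1 = P.act (s ⟨P.proj a.1, a.2⟩) k :=
      fun a => transitive _ _ (hsp ⟨P.proj a.1, a.2⟩).symm
    choose k hk using ex
    have hpa : ∀ y k, P.proj (P.act (s y) k) = y := fun y k => by rw [P.proj_act, hsp]
    refine ⟨U, hU, hx,
      { toFun := fun z => ⟨P.act (s z.1) z.2, by rw [hpa]; exact z.1.2⟩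
        invFun := fun a => (⟨P.proj a.1, a.2⟩, k a)
        left_inv := fun z => ?_
        right_inv := fun a => Subtype.ext (hk a).symm }, ?_, ?_, ?_⟩
    · have h1 : (⟨P.proj (P.act (s z.1) z.2), by rw [hpa]; exact z.1.2⟩ : U) = z.1 :=
        Subtype.ext (hpa _ _)
      refine Prod.ext h1 (free (s z.1) ?_)
      have := hk ⟨P.act (s z.1) z.2, by rw [hpa]; exact z.1.2⟩
      simp only [h1] at this
      exact this.symm
    · exact (smooth_act.comp ((hs.comp dSmooth_id.fst).prodMk dSmooth_id.snd)).subtypeMk _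
    · refine DSmooth.prodMk ((smooth_proj.comp dSmooth_subtypeVal).subtypeMk _) fun n p hp => ?_
      refine smooth_div n (fun y => s ⟨P.proj (p y).1, (p y).2⟩) (fun y => (p y).1) _ ?_ hp
        fun y => hk _
      exact hs n (fun y => ⟨P.proj (p y).1, (p y).2⟩) (smooth_proj n _ hp)
    · exact fun y k k' => ⟨hpa y k, P.act_mul _ _ _⟩

namespace IsPrincipal

theorem exists_localSection (h : P.IsPrincipal) (x : X) : ∃ U : Set X, IsOpen[dTopology] U ∧ x ∈ U ∧
    ∃ s : U → P.Carrier, DSmooth s ∧ ∀ y, P.proj (s y) = y := by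
  obtain ⟨U, hU, hx, φ, hφ, -, hφ'⟩ := h.locally_trivial x
  exact ⟨U, hU, hx, fun y => (φ (y, 1)).1, (hφ.comp (dSmooth_id.prodMk dSmooth_const)).subtypeVal,
    fun y => (hφ' y 1 1).1⟩

theorem surjective_proj (h : P.IsPrincipal) : Function.Surjective P.proj := fun x => by
  obtain ⟨U, -, hx, s, -, hs⟩ := h.exists_localSection x
  exact ⟨s ⟨x, hx⟩, hs _⟩

/-- In a local trivialisation the action is right translation in the group, which is free. -/
theorem act_injective (h : P.IsPrincipal) (a : P.Carrier) : Function.Injective (P.act a) := by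
  intro k k' hk
  obtain ⟨U, -, hx, φ, -, -, hφ⟩ := h.locally_trivial (P.proj a)
  obtain ⟨⟨y, l⟩, hl⟩ := φ.surjective ⟨a, hx⟩
  have hl' : (φ (y, l)).1 = a := by rw [hl]
  have : φ (y, l * k) = φ (y, l * k') := Subtype.ext <| by
    rw [(hφ _ _ _).2, (hφ _ _ _).2, hl', hk]
  simpa using φ.injective this

theorem dSmooth_act (h : P.IsPrincipal) {Y : Type*} [DiffeologicalSpace Y] {a : Y → P.Carrier}
    {k : Y → K} (ha : DSmooth a) (hk : DSmooth k) : DSmooth fun y => P.act (a y) (k y) :=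
  h.smooth_act.comp (ha.prodMk hk)

/-- Division in the fibres of a principal bundle is smooth. -/
theorem dSmooth_div [DiffeologicalGroup K] (h : P.IsPrincipal) {Y : Type*} [DiffeologicalSpace Y]
    {a b : Y → P.Carrier} {k : Y → K} (ha : DSmooth a) (hb : DSmooth b)
    (hk : ∀ y, b y = P.act (a y) (k y)) : DSmooth k := by
  refine dSmooth_of_locally fun y₀ => ?_
  obtain ⟨U, hU, hx, φ, -, hφ, hφ'⟩ := h.locally_trivial (P.proj (a y₀))
  refine ⟨(fun y => P.proj (a y)) ⁻¹' U, (h.smooth_proj.comp ha).isOpen_preimage hU, hx, ?_⟩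
  have hbU : ∀ y : (fun y => P.proj (a y)) ⁻¹' U, P.proj (b y) ∈ U := fun y => by
    rw [hk, P.proj_act]; exact y.2
  -- In the trivialisation `a` becomes `(z, l)` and `b` becomes `(z, l k)`, so `k` is a quotient of
  -- two smooth group coordinates.
  have key : ∀ y : (fun y => P.proj (a y)) ⁻¹' U,
      k y = (φ.symm ⟨a y, y.2⟩).2⁻¹ * (φ.symm ⟨b y, hbU y⟩).2 := by
    intro y
    rw [eq_inv_mul_iff_mul_eq]
    obtain ⟨⟨z, l⟩, hl⟩ := φ.surjective ⟨a y, y.2⟩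
    have hl' : (φ (z, l)).1 = a y := by rw [hl]
    have hb' : (⟨b y, hbU y⟩ : {p // P.proj p ∈ U}) = φ (z, l * k y) := Subtype.ext <| by
      rw [(hφ' _ _ _).2, hl']; exact hk y
    rw [hb', ← hl, Equiv.symm_apply_apply, Equiv.symm_apply_apply]
  simp only [key]
  exact DiffeologicalGroup.dSmooth_mul
    (DiffeologicalGroup.dSmooth_inv (hφ.comp ((ha.comp dSmooth_subtypeVal).subtypeMk _)).snd)
    (hφ.comp ((hb.comp dSmooth_subtypeVal).subtypeMk _)).snd

theorem dSmooth_gaugeMap [DiffeologicalGroup K] (h : P.IsPrincipal) (ψ : P.Gauge) :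
    DSmooth (h.gaugeMap ψ) :=
  h.dSmooth_div dSmooth_id ψ.smooth (h.act_gaugeMap ψ)

/-- Both sides describe `ψ(q k) = ψ(q) k` relative to `q`; freeness of the action cancels `q`. -/
theorem gaugeMap_act (h : P.IsPrincipal) (ψ : P.Gauge) (q : P.Carrier) (k : K) :
    h.gaugeMap ψ (P.act q k) = k⁻¹ * h.gaugeMap ψ q * k := by
  rw [mul_assoc, eq_inv_mul_iff_mul_eq]
  apply h.act_injective q
  rw [P.act_mul, P.act_mul, ← h.act_gaugeMap, ← h.act_gaugeMap, ψ.map_act]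

theorem pullback [DiffeologicalGroup K] (h : P.IsPrincipal) {Y : Type*} [DiffeologicalSpace Y]
    {f : Y → X} (hf : DSmooth f) : (P.pullback f).IsPrincipal := by
  refine isPrincipal_of_localSections ?_ ?_ (fun y => ?_) ?_ ?_ ?_
  · exact dSmooth_subtypeVal.fst
  · exact ((dSmooth_id.fst.subtypeVal.fst).prodMk
      (h.dSmooth_act dSmooth_id.fst.subtypeVal.snd dSmooth_id.snd)).subtypeMk _
  · obtain ⟨U, hU, hx, s, hs, hsp⟩ := h.exists_localSection (f y)
    refine ⟨f ⁻¹' U, hf.isOpen_preimage hU, hx,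
      fun z => ⟨(z.1, s ⟨f z.1, z.2⟩), (hsp ⟨f z.1, z.2⟩).symm⟩, ?_, fun z => rfl⟩
    exact (dSmooth_subtypeVal.prodMk
      (hs.comp ((hf.comp dSmooth_subtypeVal).subtypeMk _))).subtypeMk _
  · intro a b hab
    obtain ⟨k, hk⟩ := h.exists_act (p := a.1.2) (p' := b.1.2) <| by
      rw [← a.2, ← b.2]; exact congrArg f hab
    exact ⟨k, Subtype.ext (Prod.ext hab hk)⟩
  · intro a k k' hk
    exact h.act_injective a.1.2 (congrArg (fun z => z.1.2) hk)
  · intro n a b k ha hb hk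
    exact (h.dSmooth_div (DSmooth.subtypeVal ha.dSmooth).snd (DSmooth.subtypeVal hb.dSmooth).snd
      fun y => congrArg (fun z => z.1.2) (hk y)).isPlot

end IsPrincipal

end RightSpace

/-! ## Line bundles associated to circle bundles -/

theorem LineFamily.dSmooth_tmul {X Y : Type*} [DiffeologicalSpace X] [DiffeologicalSpace Y]
    {L L' : LineFamily X} {x : Y → X} {u : ∀ y, L.Fiber (x y)} {v : ∀ y, L'.Fiber (x y)}
    (hu : DSmooth fun y => (⟨x y, u y⟩ : Σ x, L.Fiber x))
    (hv : DSmooth fun y => (⟨x y, v y⟩ : Σ x, L'.Fiber x)) :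
    DSmooth fun y => (⟨x y, u y ⊗ₜ[ℂ] v y⟩ : Σ x, (L.tensor L').Fiber x) :=
  fun n p hp => DiffeologicalSpace.isPlot_generatedFrom_of_mem
    ⟨fun y => ⟨(⟨x (p y), u (p y)⟩, ⟨x (p y), v (p y)⟩), rfl⟩, ⟨hu n p hp, hv n p hp⟩, rfl⟩

namespace RightSpace

variable {X : Type*} [DiffeologicalSpace X] {P : RightSpace Circle X}

/-- Evaluation of an element of a fibre of the associated line bundle at a point of `P`. -/
def lineEval (P : RightSpace Circle X) (a : P.Carrier) {x : X} (ha : P.proj a = x) :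
    P.line.Fiber x →ₗ[ℂ] ℂ where
  toFun f := f.1 ⟨a, ha⟩
  map_add' _ _ := rfl
  map_smul' _ _ := rfl

theorem lineEval_of_eq_act {a b : P.Carrier} {x : X} (ha : P.proj a = x) (hb : P.proj b = x)
    {t : Circle} (ht : b = P.act a t) (f : P.line.Fiber x) :
    P.lineEval b hb f = ((t⁻¹ : Circle) : ℂ) * P.lineEval a ha f := by
  subst ht
  rw [Circle.coe_inv]
  exact f.2 ⟨a, ha⟩ t

/-- A family of elements of `P.line` is smooth if its values along a smooth family of points of `P`
are smooth. -/
theorem isPlot_line {n : ℕ} {σ : EuclideanSpace ℝ (Fin n) → Σ x, P.line.Fiber x}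
    {a : EuclideanSpace ℝ (Fin n) → P.Carrier} (ha : ∀ y, P.proj (a y) = (σ y).1) (hp : IsPlot a)
    (hσ : IsPlot fun y => P.lineEval (a y) (ha y) (σ y).2) : IsPlot σ :=
  DiffeologicalSpace.isPlot_generatedFrom_of_mem ⟨a, ha, hp, hσ⟩

namespace IsPrincipal

/-- The fibre is a single orbit, so the value at `a` determines an equivariant function. Conversely
`a k ↦ k⁻¹ z` is well defined because the action is free. -/
theorem lineEval_bijective (h : P.IsPrincipal) (a : P.Carrier) {x : X} (ha : P.proj a = x) :
    Function.Bijective (P.lineEval a ha) := by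
  constructor
  · rw [injective_iff_map_eq_zero]
    intro f hf
    refine Subtype.ext (funext fun b => ?_)
    obtain ⟨k, hk⟩ := h.exists_act (p := a) (p' := b.1) (by rw [b.2, ha])
    change P.lineEval b.1 b.2 f = 0
    rw [lineEval_of_eq_act ha b.2 hk, hf, mul_zero]
  · intro z
    have ex : ∀ b : {b // P.proj b = x}, ∃ k, b.1 = P.act a k :=
      fun b => h.exists_act (by rw [b.2, ha])
    choose k hk using ex
    refine ⟨⟨fun b => (k b : ℂ)⁻¹ * z, fun b t => ?_⟩, ?_⟩
    · have : k ⟨P.act b.1 t, by rw [P.proj_act]; exact b.2⟩ = k b * t := by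
        apply h.act_injective a
        rw [P.act_mul, ← hk, ← hk]
      change (k ⟨P.act b.1 t, _⟩ : ℂ)⁻¹ * z = (t : ℂ)⁻¹ * ((k b : ℂ)⁻¹ * z)
      rw [this, Circle.coe_mul, mul_inv_rev, mul_assoc]
    · have : k ⟨a, ha⟩ = 1 := by
        apply h.act_injective a
        rw [← hk, P.act_one]
      change (k ⟨a, ha⟩ : ℂ)⁻¹ * z = z
      simp [this]

/-- Evaluation at a point, as an isomorphism of a fibre of the associated line bundle with `ℂ`. -/
noncomputable def lineEquiv (h : P.IsPrincipal) (a : P.Carrier) {x : X} (ha : P.proj a = x) :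
    P.line.Fiber x ≃ₗ[ℂ] ℂ :=
  .ofBijective (P.lineEval a ha) (h.lineEval_bijective a ha)

theorem lineEquiv_of_eq_act (h : P.IsPrincipal) {a b : P.Carrier} {x : X} (ha : P.proj a = x)
    (hb : P.proj b = x) {t : Circle} (ht : b = P.act a t) (f : P.line.Fiber x) :
    h.lineEquiv b hb f = (t : ℂ)⁻¹ * h.lineEquiv a ha f :=
  (lineEval_of_eq_act ha hb ht f).trans (by rw [Circle.coe_inv]; rfl)

theorem lineEquiv_act_symm (h : P.IsPrincipal) (a : P.Carrier) {x : X} (ha : P.proj a = x)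
    (t : Circle) (ht : P.proj (P.act a t) = x) (z : ℂ) :
    (h.lineEquiv (P.act a t) ht).symm z = (t : ℂ) • (h.lineEquiv a ha).symm z := by
  rw [LinearEquiv.symm_apply_eq, h.lineEquiv_of_eq_act ha ht rfl, map_smul, LinearEquiv.apply_symm_apply,
    smul_eq_mul, inv_mul_cancel_left₀ (Circle.coe_ne_zero t)]

theorem dSmooth_line_proj (h : P.IsPrincipal) : DSmooth fun f : Σ x, P.line.Fiber x => f.1 := by
  refine dSmooth_generateFrom fun n σ hσ => ?_
  obtain ⟨a, ha, hp, -⟩ := hσ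
  have : (fun f : Σ x, P.line.Fiber x => f.1) ∘ σ = P.proj ∘ a := funext fun y => (ha y).symm
  rw [this]
  exact h.smooth_proj n a hp

/-- Smooth families of elements of the associated line bundle have smooth values along every smooth
family of points of `P`. -/
theorem isPlot_lineEval (h : P.IsPrincipal) {n : ℕ}
    {σ : EuclideanSpace ℝ (Fin n) → Σ x, P.line.Fiber x} (hσ : IsPlot σ)
    {a : EuclideanSpace ℝ (Fin n) → P.Carrier} (hp : IsPlot a)
    (ha : ∀ y, P.proj (a y) = (σ y).1) :
    IsPlot fun y => P.lineEval (a y) (ha y) (σ y).2 := by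
  -- The families with the desired property form a diffeology `D`. Quantifying over
  -- reparametrisations `r` makes `D` stable under them; it then suffices that the generators belong
  -- to `D`.
  let D : DiffeologicalSpace (Σ x, P.line.Fiber x) :=
    { plots := fun n => {σ | ∀ (m : ℕ) (r : EuclideanSpace ℝ (Fin m) → EuclideanSpace ℝ (Fin n))
        (a : EuclideanSpace ℝ (Fin m) → P.Carrier) (ha : ∀ y, P.proj (a y) = (σ (r y)).1),
        ContDiff ℝ ∞ r → IsPlot a → IsPlot fun y => P.lineEval (a y) (ha y) (σ (r y)).2}
      constant_plots := by
        intro n f m r a ha hr hp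
        -- For a constant family all points `a y` lie in one fibre, so they are compared with the
        -- reference point `a 0`.
        have ex : ∀ y, ∃ k, a y = P.act (a 0) k := fun y => h.exists_act ((ha y).trans (ha 0).symm)
        choose k hk using ex
        have hk' : IsPlot k := (h.dSmooth_div dSmooth_const hp.dSmooth hk).isPlot
        have : (fun y => P.lineEval (a y) (ha y) f.2) =
            fun y => (((k y)⁻¹ : Circle) : ℂ) * P.lineEval (a 0) (ha 0) f.2 :=
          funext fun y => lineEval_of_eq_act (ha 0) (ha y) (hk y) f.2
        exact this ▸ (Complex.dSmooth_mul (Circle.dSmooth_coe.comp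
          (DiffeologicalGroup.dSmooth_inv hk'.dSmooth)) dSmooth_const).isPlot
      plot_reparam := by
        intro n m σ f hσ hf l r a ha hr hp
        exact hσ l (f ∘ r) a ha (hf.comp hr) hp
      locality := by
        intro n σ hσ m r a ha hr hp
        refine DiffeologicalSpace.locality fun y => ?_
        obtain ⟨u, hu, hyu, H⟩ := hσ (r y)
        refine ⟨r ⁻¹' u, hu.preimage hr.continuous, hyu, fun {l f} hf hf' => ?_⟩
        exact H hf (hr.comp hf') l id (a ∘ f) (fun y => ha (f y)) contDiff_id (isPlot_reparam hp hf') }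
  refine hσ D ?_ n id a ha contDiff_id hp
  rintro ⟨n, σ⟩ ⟨b, hb, hbp, hσb⟩ m r a ha hr hp
  -- A generator has smooth values along its own family `b`; passing from `b ∘ r` to `a` multiplies
  -- them by the smooth factor `k⁻¹`.
  have ex : ∀ y, ∃ k, a y = P.act (b (r y)) k :=
    fun y => h.exists_act ((ha y).trans (hb (r y)).symm)
  choose k hk using ex
  have hk' : IsPlot k := (h.dSmooth_div (isPlot_reparam hbp hr).dSmooth hp.dSmooth hk).isPlot
  have : (fun y => P.lineEval (a y) (ha y) (σ (r y)).2) =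
      fun y => (((k y)⁻¹ : Circle) : ℂ) * P.lineEval (b (r y)) (hb (r y)) (σ (r y)).2 :=
    funext fun y => lineEval_of_eq_act (hb (r y)) (ha y) (hk y) _
  have h2 : IsPlot fun y => P.lineEval (b (r y)) (hb (r y)) (σ (r y)).2 :=
    isPlot_reparam (X := ℂ) (p := fun y => P.lineEval (b y) (hb y) (σ y).2) hσb hr
  exact this ▸ (Complex.dSmooth_mul (Circle.dSmooth_coe.comp
    (DiffeologicalGroup.dSmooth_inv hk'.dSmooth)) h2.dSmooth).isPlot

theorem dSmooth_lineEquiv (h : P.IsPrincipal) {Y : Type*} [DiffeologicalSpace Y]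
    {σ : Y → Σ x, P.line.Fiber x} {a : Y → P.Carrier} (hσ : DSmooth σ) (ha : DSmooth a)
    (hp : ∀ y, P.proj (a y) = (σ y).1) : DSmooth fun y => h.lineEquiv (a y) (hp y) (σ y).2 :=
  fun n p hpl => h.isPlot_lineEval (hσ n p hpl) (ha n p hpl) fun y => hp (p y)

theorem dSmooth_lineEquiv_symm (h : P.IsPrincipal) {Y : Type*} [DiffeologicalSpace Y]
    {x : Y → X} {a : Y → P.Carrier} {z : Y → ℂ} (ha : DSmooth a) (hz : DSmooth z)
    (hp : ∀ y, P.proj (a y) = x y) :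
    DSmooth fun y => (⟨x y, (h.lineEquiv (a y) (hp y)).symm (z y)⟩ : Σ x, P.line.Fiber x) := by
  intro n r hr
  refine isPlot_line (fun y => hp (r y)) (ha n r hr) ?_
  have : (fun y => P.lineEval (a (r y)) (hp (r y))
      ((h.lineEquiv (a (r y)) (hp (r y))).symm (z (r y)))) = z ∘ r :=
    funext fun y => (h.lineEquiv (a (r y)) (hp (r y))).apply_symm_apply _
  exact this ▸ hz n r hr

/-- The line bundle associated to a principal circle bundle is a line bundle. -/
theorem isLineBundle_line (h : P.IsPrincipal) : P.line.IsLineBundle where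
  smooth_proj := h.dSmooth_line_proj
  locally_trivial x := by
    obtain ⟨U, hU, hx, s, hs, hsp⟩ := h.exists_localSection x
    refine ⟨U, hU, hx, fun y => (h.lineEquiv (s y) (hsp y)).symm, ?_, ?_⟩
    · exact h.dSmooth_lineEquiv_symm (hs.comp dSmooth_id.fst) dSmooth_id.snd fun z => hsp z.1
    · exact h.dSmooth_lineEquiv dSmooth_subtypeVal
        (hs.comp ((h.dSmooth_line_proj.comp dSmooth_subtypeVal).subtypeMk _)) fun f => hsp _

end IsPrincipal

/-! ## Bilinear maps of circle bundles -/

section Bilinear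

universe u₀ u₁ u₂ u₃

variable {X : Type u₀} {P : RightSpace.{0, u₀, u₁} Circle X}
  {R : RightSpace.{0, u₀, u₂} Circle X} {S : RightSpace.{0, u₀, u₃} Circle X}

/-- A smooth fibrewise map `P ×_X R → S` that is equivariant in both arguments. -/
structure BiequivariantMap (P : RightSpace.{0, u₀, u₁} Circle X)
    (R : RightSpace.{0, u₀, u₂} Circle X) (S : RightSpace.{0, u₀, u₃} Circle X) where
  toFun : {z : P.Carrier × R.Carrier // P.proj z.1 = R.proj z.2} → S.Carrier
  smooth : DSmooth toFun
  proj_apply : ∀ z, S.proj (toFun z) = P.proj z.1.1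
  map_act_left : ∀ a b (h : P.proj a = R.proj b) t (h' : P.proj (P.act a t) = R.proj b),
    toFun ⟨(P.act a t, b), h'⟩ = S.act (toFun ⟨(a, b), h⟩) t
  map_act_right : ∀ a b (h : P.proj a = R.proj b) t (h' : P.proj a = R.proj (R.act b t)),
    toFun ⟨(a, R.act b t), h'⟩ = S.act (toFun ⟨(a, b), h⟩) t

namespace BiequivariantMap

variable (m : BiequivariantMap P R S)

/-- The map `P ⊗ R → S` induced by a biequivariant map. -/
def lift : (P.tensor R).Carrier → S.Carrier :=
  Quot.lift m.toFun <| by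
    rintro ⟨⟨a, b⟩, hz⟩ ⟨⟨a', b'⟩, hz'⟩ ⟨t, ha, hb⟩
    dsimp only at ha hb hz hz'
    subst ha hb
    rw [m.map_act_left a _ (by rw [R.proj_act]; exact hz) t,
      m.map_act_right a b hz t⁻¹, ← S.act_mul, inv_mul_cancel, S.act_one]

theorem proj_lift (c : (P.tensor R).Carrier) : S.proj (m.lift c) = (P.tensor R).proj c := by
  induction c using Quot.ind with
  | mk z => exact m.proj_apply z

theorem lift_act (c : (P.tensor R).Carrier) (t : Circle) :
    m.lift ((P.tensor R).act c t) = S.act (m.lift c) t := by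
  induction c using Quot.ind with
  | mk z => exact m.map_act_left _ _ _ t _

variable [DiffeologicalSpace X]

/-- An equivariant map of circle torsors is bijective. For injectivity, equal images of `(a, b)` and
`(a t, b t')` force `t' t = 1`, which is exactly the antidiagonal relation. -/
theorem lift_bijective (hP : P.IsPrincipal) (hR : R.IsPrincipal) (hS : S.IsPrincipal) :
    Function.Bijective m.lift := by
  constructor
  · intro c c' hc
    have hproj : (P.tensor R).proj c = (P.tensor R).proj c' := by
      rw [← m.proj_lift, ← m.proj_lift, hc]
    induction c using Quot.ind with | mk z => ?_
    induction c' using Quot.ind with | mk z' => ?_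
    obtain ⟨⟨a, b⟩, hz⟩ := z
    obtain ⟨⟨a', b'⟩, hz'⟩ := z'
    change P.proj a = P.proj a' at hproj
    obtain ⟨t, rfl⟩ := hP.exists_act hproj.symm
    obtain ⟨t', rfl⟩ := hR.exists_act (p := b) (p' := b') (by
      rw [← show P.proj a = R.proj b from hz, hproj]; exact hz'.symm)
    refine Quot.sound ⟨t, rfl, ?_⟩
    have hc' : m.toFun ⟨(a, b), hz⟩ = m.toFun ⟨(P.act a t, R.act b t'), hz'⟩ := hc
    rw [m.map_act_left a _ (by rw [R.proj_act]; exact hz) t,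
      m.map_act_right a b hz t', ← S.act_mul] at hc'
    have := hS.act_injective _ ((S.act_one _).trans hc')
    change R.act b t' = R.act b t⁻¹
    rw [eq_inv_of_mul_eq_one_left this.symm]
  · intro c
    obtain ⟨a, ha⟩ := hP.surjective_proj (S.proj c)
    obtain ⟨b, hb⟩ := hR.surjective_proj (S.proj c)
    obtain ⟨t, ht⟩ := hS.exists_act (p := m.toFun ⟨(a, b), ha.trans hb.symm⟩) (p' := c)
      (ha.symm.trans (m.proj_apply ⟨(a, b), ha.trans hb.symm⟩).symm)
    refine ⟨Quot.mk _ ⟨(P.act a t, b), by rw [P.proj_act]; exact ha.trans hb.symm⟩, ?_⟩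
    exact (m.map_act_left _ _ _ _ _).trans ht.symm

/-- A biequivariant map `P ×_X R → S` identifies `S` with `P ⊗ R`. -/
theorem nonempty_iso_tensor (m : BiequivariantMap P R S) (hP : P.IsPrincipal)
    (hR : R.IsPrincipal) (hS : S.IsPrincipal) :
    Nonempty (S.Iso (P.tensor R)) := by
  let e := Equiv.ofBijective m.lift (m.lift_bijective hP hR hS)
  refine ⟨⟨e.symm, ?_, ?_, fun c => ?_, fun c t => ?_⟩⟩
  -- With local sections `a`, `b` of the factors, a point of `S` is `m(a, b) t` with `t` smooth by
  -- division, and its preimage is the class of `(a t, b)`.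
  · refine dSmooth_of_locally fun c => ?_
    obtain ⟨U, hU, hxU, s, hs, hsp⟩ := hP.exists_localSection (S.proj c)
    obtain ⟨V, hV, hxV, r, hr, hrp⟩ := hR.exists_localSection (S.proj c)
    refine ⟨_, isOpen_inter (hS.smooth_proj.isOpen_preimage hU)
      (hS.smooth_proj.isOpen_preimage hV), ⟨hxU, hxV⟩, ?_⟩
    let Y : Type _ := ↥(S.proj ⁻¹' U ∩ S.proj ⁻¹' V)
    let a : Y → P.Carrier := fun y => s ⟨S.proj y.1, y.2.1⟩
    let b : Y → R.Carrier := fun y => r ⟨S.proj y.1, y.2.2⟩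
    have ha : DSmooth a := hs.comp ((hS.smooth_proj.comp dSmooth_subtypeVal).subtypeMk _)
    have hb : DSmooth b := hr.comp ((hS.smooth_proj.comp dSmooth_subtypeVal).subtypeMk _)
    have hap : ∀ y, P.proj (a y) = S.proj y.1 := fun y => hsp _
    have hbp : ∀ y, R.proj (b y) = S.proj y.1 := fun y => hrp _
    have ex : ∀ y : Y, ∃ t, y.1 = S.act (m.toFun ⟨(a y, b y), (hap y).trans (hbp y).symm⟩) t :=
      fun y => hS.exists_act (by rw [m.proj_apply]; exact (hap y).symm)
    choose t ht using ex
    have hts : DSmooth t :=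
      hS.dSmooth_div (m.smooth.comp ((ha.prodMk hb).subtypeMk _)) dSmooth_subtypeVal ht
    have key : ∀ y : Y, e.symm y.1 = Quot.mk _ ⟨(P.act (a y) (t y), b y), by
        rw [P.proj_act]; exact (hap y).trans (hbp y).symm⟩ := by
      intro y
      exact (Equiv.symm_apply_eq e).2 ((ht y).trans (m.map_act_left _ _ _ _ _).symm)
    change DSmooth fun y : Y => e.symm y.1
    simp only [key]
    exact (dSmooth_into_coinduced _).comp (((hP.dSmooth_act ha hts).prodMk hb).subtypeMk _)
  · exact dSmooth_coinduced m.smooth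
  · rw [← m.proj_lift]
    exact congrArg S.proj (e.apply_symm_apply c)
  · rw [Equiv.symm_apply_eq]
    refine Eq.trans ?_ (m.lift_act _ _).symm
    exact congrArg (S.act · t) (e.apply_symm_apply c).symm

/-- The isomorphism of fibres `S_x → P_x ⊗ R_x` determined by points of `P_x` and `R_x`. -/
noncomputable def fiberEquiv (hP : P.IsPrincipal) (hR : R.IsPrincipal) (hS : S.IsPrincipal) {x : X}
    (a : P.Carrier) (b : R.Carrier) (ha : P.proj a = x) (hb : R.proj b = x) :
    S.line.Fiber x ≃ₗ[ℂ] P.line.Fiber x ⊗[ℂ] R.line.Fiber x :=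
  (hS.lineEquiv (m.toFun ⟨(a, b), ha.trans hb.symm⟩) ((m.proj_apply _).trans ha)).trans <|
    (TensorProduct.lid ℂ ℂ).symm.trans
      (TensorProduct.congr (hP.lineEquiv a ha).symm (hR.lineEquiv b hb).symm)

theorem fiberEquiv_apply (hP : P.IsPrincipal) (hR : R.IsPrincipal) (hS : S.IsPrincipal) {x : X}
    (a : P.Carrier) (b : R.Carrier) (ha : P.proj a = x) (hb : R.proj b = x)
    (f : S.line.Fiber x) : m.fiberEquiv hP hR hS a b ha hb f =
      (hP.lineEquiv a ha).symm 1 ⊗ₜ (hR.lineEquiv b hb).symm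
        (hS.lineEquiv (m.toFun ⟨(a, b), ha.trans hb.symm⟩) ((m.proj_apply _).trans ha) f) :=
  rfl

theorem fiberEquiv_symm_tmul (hP : P.IsPrincipal) (hR : R.IsPrincipal) (hS : S.IsPrincipal) {x : X}
    (a : P.Carrier) (b : R.Carrier) (ha : P.proj a = x) (hb : R.proj b = x)
    (f : P.line.Fiber x) (g : R.line.Fiber x) : (m.fiberEquiv hP hR hS a b ha hb).symm (f ⊗ₜ g) =
      (hS.lineEquiv (m.toFun ⟨(a, b), ha.trans hb.symm⟩) ((m.proj_apply _).trans ha)).symm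
        (hP.lineEquiv a ha f * hR.lineEquiv b hb g) :=
  rfl

/-- Replacing `(a, b)` by `(a t, b t')` multiplies evaluation at `m(a, b)` by `(t t')⁻¹` and the two
inverse evaluations by `t` and `t'`; the factors cancel. Global isomorphisms can therefore be
defined with arbitrary points and computed with smooth local sections. -/
theorem fiberEquiv_eq (hP : P.IsPrincipal) (hR : R.IsPrincipal) (hS : S.IsPrincipal) {x : X}
    (a a' : P.Carrier) (b b' : R.Carrier) (ha : P.proj a = x) (hb : R.proj b = x)
    (ha' : P.proj a' = x) (hb' : R.proj b' = x) :
    m.fiberEquiv hP hR hS a b ha hb = m.fiberEquiv hP hR hS a' b' ha' hb' := by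
  obtain ⟨t, rfl⟩ := hP.exists_act (ha'.trans ha.symm)
  obtain ⟨t', rfl⟩ := hR.exists_act (hb'.trans hb.symm)
  ext f
  have hm : m.toFun ⟨(P.act a t, R.act b t'), ha'.trans hb'.symm⟩ =
      S.act (m.toFun ⟨(a, b), ha.trans hb.symm⟩) (t * t') := by
    rw [S.act_mul, ← m.map_act_left a b (ha.trans hb.symm) t (ha'.trans hb.symm),
      ← m.map_act_right]
  have hf : hS.lineEquiv _ _ f = ((t * t' : Circle) : ℂ)⁻¹ • hS.lineEquiv _ _ f :=
    hS.lineEquiv_of_eq_act ((m.proj_apply _).trans ha) ((m.proj_apply _).trans ha') hm f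
  change m.fiberEquiv hP hR hS a b ha hb f = m.fiberEquiv hP hR hS _ _ ha' hb' f
  rw [fiberEquiv_apply, fiberEquiv_apply, hP.lineEquiv_act_symm a ha, hR.lineEquiv_act_symm b hb,
    TensorProduct.tmul_smul, TensorProduct.smul_tmul', smul_smul, hf, map_smul,
    TensorProduct.tmul_smul, TensorProduct.smul_tmul', smul_smul, Circle.coe_mul,
    mul_comm (t' : ℂ), inv_mul_cancel₀, one_smul]
  exact mul_ne_zero (Circle.coe_ne_zero t) (Circle.coe_ne_zero t')

/-- A biequivariant map `P ×_X R → S` identifies the line bundle associated to `S` with the tensor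
product of those associated to `P` and `R`. -/
theorem nonempty_line_iso_tensor (m : BiequivariantMap P R S) (hP : P.IsPrincipal)
    (hR : R.IsPrincipal) (hS : S.IsPrincipal) :
    Nonempty (S.line.Iso (P.line.tensor R.line)) := by
  -- These points need not vary smoothly; `fiberEquiv_eq` later exchanges them for smooth local
  -- sections.
  choose a ha using hP.surjective_proj
  choose b hb using hR.surjective_proj
  refine ⟨⟨fun x => m.fiberEquiv hP hR hS (a x) (b x) (ha x) (hb x), ?_, ?_⟩⟩
  · refine dSmooth_of_locally fun f => ?_
    obtain ⟨U, hU, hxU, s, hs, hsp⟩ := hP.exists_localSection f.1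
    obtain ⟨V, hV, hxV, r, hr, hrp⟩ := hR.exists_localSection f.1
    have hpr := hS.dSmooth_line_proj
    refine ⟨_, isOpen_inter (hpr.isOpen_preimage hU)
      (hpr.isOpen_preimage hV), ⟨hxU, hxV⟩, ?_⟩
    let Y : Type _ := ↥((fun f : Σ x, S.line.Fiber x => f.1) ⁻¹' U ∩
      (fun f : Σ x, S.line.Fiber x => f.1) ⁻¹' V)
    let a' : Y → P.Carrier := fun y => s ⟨y.1.1, y.2.1⟩
    let b' : Y → R.Carrier := fun y => r ⟨y.1.1, y.2.2⟩
    have ha' : DSmooth a' := hs.comp ((hpr.comp dSmooth_subtypeVal).subtypeMk _)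
    have hb' : DSmooth b' := hr.comp ((hpr.comp dSmooth_subtypeVal).subtypeMk _)
    have hap : ∀ y : Y, P.proj (a' y) = y.1.1 := fun y => hsp _
    have hbp : ∀ y : Y, R.proj (b' y) = y.1.1 := fun y => hrp _
    have key : ∀ y : Y, m.fiberEquiv hP hR hS (a y.1.1) (b y.1.1) (ha y.1.1) (hb y.1.1) =
        m.fiberEquiv hP hR hS (a' y) (b' y) (hap y) (hbp y) :=
      fun y => m.fiberEquiv_eq hP hR hS _ _ _ _ _ _ _ _
    have hz : DSmooth fun y : Y => hS.lineEquiv (m.toFun ⟨(a' y, b' y), (hap y).trans (hbp y).symm⟩)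
        ((m.proj_apply _).trans (hap y)) y.1.2 :=
      hS.dSmooth_lineEquiv dSmooth_subtypeVal (m.smooth.comp ((ha'.prodMk hb').subtypeMk _)) _
    have := LineFamily.dSmooth_tmul
      (hP.dSmooth_lineEquiv_symm ha' (dSmooth_const (y := (1 : ℂ))) hap)
      (hR.dSmooth_lineEquiv_symm hb' hz hbp)
    refine Eq.mp (congrArg DSmooth (funext fun y => ?_)) this
    exact congrArg (Sigma.mk y.1.1) (LinearEquiv.congr_fun (key y) y.1.2).symm
  · refine dSmooth_coinduced ?_
    refine dSmooth_of_locally fun z => ?_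
    obtain ⟨U, hU, hxU, s, hs, hsp⟩ := hP.exists_localSection z.1.2.1
    obtain ⟨V, hV, hxV, r, hr, hrp⟩ := hR.exists_localSection z.1.2.1
    have hpr : DSmooth fun z : {z : (Σ x, P.line.Fiber x) × (Σ x, R.line.Fiber x) //
        z.1.1 = z.2.1} => z.1.2.1 := hR.dSmooth_line_proj.comp dSmooth_subtypeVal.snd
    refine ⟨_, isOpen_inter (hpr.isOpen_preimage hU)
      (hpr.isOpen_preimage hV), ⟨hxU, hxV⟩, ?_⟩
    let Y : Type _ := ↥((fun z : {z : (Σ x, P.line.Fiber x) × (Σ x, R.line.Fiber x) //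
      z.1.1 = z.2.1} => z.1.2.1) ⁻¹' U ∩ (fun z => z.1.2.1) ⁻¹' V)
    let a' : Y → P.Carrier := fun y => s ⟨y.1.1.2.1, y.2.1⟩
    let b' : Y → R.Carrier := fun y => r ⟨y.1.1.2.1, y.2.2⟩
    have ha' : DSmooth a' := hs.comp ((hpr.comp dSmooth_subtypeVal).subtypeMk _)
    have hb' : DSmooth b' := hr.comp ((hpr.comp dSmooth_subtypeVal).subtypeMk _)
    have hap : ∀ y : Y, P.proj (a' y) = y.1.1.2.1 := fun y => hsp _
    have hap' : ∀ y : Y, P.proj (a' y) = y.1.1.1.1 := fun y => (hsp _).trans y.1.2.symm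
    have hbp : ∀ y : Y, R.proj (b' y) = y.1.1.2.1 := fun y => hrp _
    -- The transport `▸` in the tensor diffeology disappears once the two base points are
    -- identified.
    have hev : ∀ (w : {z : (Σ x, P.line.Fiber x) × (Σ x, R.line.Fiber x) // z.1.1 = z.2.1})
        (c : P.Carrier) (hc : P.proj c = w.1.2.1) (hc' : P.proj c = w.1.1.1),
        hP.lineEquiv c hc (w.2 ▸ w.1.1.2) = hP.lineEquiv c hc' w.1.1.2 := by
      rintro ⟨⟨⟨x, f⟩, ⟨x', g⟩⟩, hw⟩ c hc hc'
      dsimp only at hw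
      subst hw
      rfl
    have key : ∀ y : Y, (m.fiberEquiv hP hR hS (a y.1.1.2.1) (b y.1.1.2.1) (ha y.1.1.2.1)
        (hb y.1.1.2.1)).symm ((y.1.2 ▸ y.1.1.1.2) ⊗ₜ[ℂ] y.1.1.2.2) =
        (hS.lineEquiv (m.toFun ⟨(a' y, b' y), (hap y).trans (hbp y).symm⟩)
          ((m.proj_apply _).trans (hap y))).symm
        (hP.lineEquiv (a' y) (hap' y) y.1.1.1.2 * hR.lineEquiv (b' y) (hbp y) y.1.1.2.2) := by
      intro y
      rw [m.fiberEquiv_eq hP hR hS _ (a' y) _ (b' y) _ _ (hap y) (hbp y), fiberEquiv_symm_tmul,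
        hev _ _ _ (hap' y)]
    change DSmooth fun y : Y => (⟨y.1.1.2.1, (m.fiberEquiv hP hR hS (a y.1.1.2.1) (b y.1.1.2.1)
      (ha y.1.1.2.1) (hb y.1.1.2.1)).symm ((y.1.2 ▸ y.1.1.1.2) ⊗ₜ[ℂ] y.1.1.2.2)⟩ :
        Σ x, S.line.Fiber x)
    simp only [key]
    exact hS.dSmooth_lineEquiv_symm (m.smooth.comp ((ha'.prodMk hb').subtypeMk _))
      (Complex.dSmooth_mul
        (hP.dSmooth_lineEquiv dSmooth_subtypeVal.subtypeVal.fst ha' hap')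
        (hR.dSmooth_lineEquiv dSmooth_subtypeVal.subtypeVal.snd hb' hbp)) _

end BiequivariantMap

end Bilinear

end RightSpace

/-! ## Lifts along central extensions -/

theorem RightSpace.act_inv_act {K : Type*} [Group K] {X : Type*} (P : RightSpace K X)
    (a : P.Carrier) (k : K) : P.act (P.act a k⁻¹) k = a := by
  rw [← P.act_mul, inv_mul_cancel, P.act_one]

theorem RightSpace.act_act_inv {K : Type*} [Group K] {X : Type*} (P : RightSpace K X)
    (a : P.Carrier) (k : K) : P.act (P.act a k) k⁻¹ = a := by
  rw [← P.act_mul, mul_inv_cancel, P.act_one]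

namespace CentralExtension

universe u v w w' w''

section

variable {K : Type*} [Group K] [DiffeologicalSpace K] {K' : Type*} [Group K']
  [DiffeologicalSpace K'] (ext : CentralExtension K K')

theorem isPrincipal_circleBundle : ext.circleBundle.IsPrincipal :=
  ext.principal

theorem dSmooth_proj : DSmooth ext.proj :=
  ext.principal.smooth_proj

theorem dSmooth_incl : DSmooth ext.incl := by
  have := ext.isPrincipal_circleBundle.dSmooth_act (dSmooth_const (y := (1 : K'))) dSmooth_id
  exact Eq.mp (congrArg DSmooth (funext fun t => one_mul (ext.incl t))) this

theorem incl_mul_comm (t : Circle) (k : K') : ext.incl t * k = k * ext.incl t :=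
  (Subgroup.mem_center_iff.1 (ext.central ⟨t, rfl⟩) k).symm

theorem exists_incl_eq {k : K'} (hk : ext.proj k = 1) : ∃ t, ext.incl t = k := by
  have : k ∈ ext.incl.range := ext.range_incl ▸ hk
  exact this

end

variable {K : Type u} [Group K] [DiffeologicalSpace K] {K' : Type v}
  [Group K'] [DiffeologicalSpace K'] {ext : CentralExtension K K'} {B : Type w}
  [DiffeologicalSpace B] {Q : RightSpace.{u, w, w'} K B} {P : RightSpace.{v, w, w''} K' B}
  {p : P.Carrier → Q.Carrier}

theorem IsLift.act_incl_act (_h : ext.IsLift Q P p) (a : P.Carrier) (t : Circle) (k : K') :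
    P.act (P.act a (ext.incl t)) k = P.act (P.act a k) (ext.incl t) := by
  rw [← P.act_mul, ← P.act_mul, ext.incl_mul_comm]

/-- The element of `K'` relating `a` and `b` fixes `p a` through its image in `K`; freeness on `Q`
puts it in the kernel, which is the circle. -/
theorem IsLift.exists_act_incl (h : ext.IsLift Q P p) (hQ : Q.IsPrincipal) {a b : P.Carrier}
    (hab : p b = p a) : ∃ t, b = P.act a (ext.incl t) := by
  obtain ⟨k, hk⟩ := h.principal.exists_act (p := a) (p' := b) (by
    rw [← h.proj_apply, ← h.proj_apply, hab])
  have hk1 : ext.proj k = 1 := by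
    apply hQ.act_injective (p a)
    rw [← h.map_act, ← hk, hab, Q.act_one]
  obtain ⟨t, rfl⟩ := ext.exists_incl_eq hk1
  exact ⟨t, hk⟩

/-- Sections of a lift, and a trivialisation of the extension, give sections over the total space
of the original bundle. -/
theorem isPrincipal_overTotal [DiffeologicalGroup K] [DiffeologicalGroup K'] (hQ : Q.IsPrincipal)
    (h : ext.IsLift Q P p) : (ext.overTotal h).IsPrincipal := by
  have hP := h.principal
  refine RightSpace.isPrincipal_of_localSections h.smooth ?_ (fun q => ?_) (fun a b hab => ?_) ?_ ?_
  · exact hP.dSmooth_act dSmooth_id.fst (ext.dSmooth_incl.comp dSmooth_id.snd)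
  · obtain ⟨U, hU, hxU, s, hs, hsp⟩ := hP.exists_localSection (Q.proj q)
    -- `κ` records the position of `q` relative to the section `p ∘ s` of `Q`. Lifting `κ` to `K'`
    -- by a local section `r` and acting on `s` yields a point of `P` over `q`.
    have ex : ∀ q : Q.proj ⁻¹' U, ∃ k, q.1 = Q.act (p (s ⟨Q.proj q.1, q.2⟩)) k := fun q =>
      hQ.exists_act (((h.proj_apply _).trans (hsp ⟨Q.proj q.1, q.2⟩)).symm)
    choose κ hκ using ex
    have hsq : DSmooth fun q : Q.proj ⁻¹' U => s ⟨Q.proj q.1, q.2⟩ :=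
      hs.comp ((hQ.smooth_proj.comp dSmooth_subtypeVal).subtypeMk _)
    have hκs : DSmooth κ := hQ.dSmooth_div (h.smooth.comp hsq) dSmooth_subtypeVal hκ
    obtain ⟨W, hW, hxW, r, hr, hrp⟩ :=
      ext.isPrincipal_circleBundle.exists_localSection (κ ⟨q, hxU⟩)
    refine ⟨_, isOpen_image_val_preimage (hQ.smooth_proj.isOpen_preimage hU) hκs hW,
      ⟨⟨q, hxU⟩, hxW, rfl⟩, ?_⟩
    let V : Set Q.Carrier := Subtype.val '' (κ ⁻¹' W)
    have hVU : ∀ y : V, Q.proj y.1 ∈ U := by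
      rintro ⟨_, ⟨y, hy⟩, -, rfl⟩
      exact hy
    have hVW : ∀ y : V, κ ⟨y.1, hVU y⟩ ∈ W := by
      rintro ⟨_, ⟨y, hy⟩, hyW, rfl⟩
      exact hyW
    have hVs : DSmooth fun y : V => (⟨y.1, hVU y⟩ : Q.proj ⁻¹' U) :=
      dSmooth_subtypeVal.subtypeMk _
    refine ⟨fun y : V => P.act (s ⟨Q.proj y.1, hVU y⟩) (r ⟨κ ⟨y.1, hVU y⟩, hVW y⟩),
      hP.dSmooth_act (hsq.comp hVs) (hr.comp ((hκs.comp hVs).subtypeMk _)), fun y => ?_⟩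
    refine (h.map_act _ _).trans ?_
    rw [show ext.proj (r ⟨κ ⟨y.1, hVU y⟩, hVW y⟩) = κ ⟨y.1, hVU y⟩ from hrp _]
    exact (hκ ⟨y.1, hVU y⟩).symm
  · exact h.exists_act_incl hQ hab
  · exact fun a t t' ht => ext.incl_injective (hP.act_injective a ht)
  · intro n a b t ha hb ht
    -- Division in `P` gives smoothness only in `K'`; dividing by `1` in the circle bundle `K' → K`
    -- then recovers `t` itself.
    have hi : DSmooth fun y => ext.incl (t y) := hP.dSmooth_div ha.dSmooth hb.dSmooth ht
    exact (ext.isPrincipal_circleBundle.dSmooth_div (dSmooth_const (y := (1 : K'))) hi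
      fun y => (one_mul (ext.incl (t y))).symm).isPlot

/-- Since `ψ` is bijective, a point `(q, a)` is determined by `a`, with `q = ψ⁻¹(p a)`; sections and
division are inherited from `P`. -/
theorem isPrincipal_gaugePullback [DiffeologicalGroup K'] (hQ : Q.IsPrincipal)
    (h : ext.IsLift Q P p) (ψ : Q.Gauge) : (ext.gaugePullback h ψ).IsPrincipal := by
  have hP := h.principal
  have hproj : ∀ z : (ext.gaugePullback h ψ).Carrier, P.proj z.1.2 = Q.proj z.1.1 := fun z => by
    rw [← h.proj_apply, ← z.2, ψ.proj_apply]
  refine RightSpace.isPrincipal_of_localSections ?_ ?_ (fun x => ?_) (fun z z' hz => ?_) ?_ ?_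
  · exact hQ.smooth_proj.comp dSmooth_subtypeVal.fst
  · exact ((hQ.dSmooth_act dSmooth_id.fst.subtypeVal.fst
      (ext.dSmooth_proj.comp dSmooth_id.snd)).prodMk
      (hP.dSmooth_act dSmooth_id.fst.subtypeVal.snd dSmooth_id.snd)).subtypeMk _
  · obtain ⟨U, hU, hxU, s, hs, hsp⟩ := hP.exists_localSection x
    refine ⟨U, hU, hxU, fun y => ⟨(ψ.toEquiv.symm (p (s y)), s y), ψ.toEquiv.apply_symm_apply _⟩,
      ((ψ.smooth_symm.comp (h.smooth.comp hs)).prodMk hs).subtypeMk _, fun y => ?_⟩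
    change Q.proj (ψ.toEquiv.symm (p (s y))) = y
    rw [← ψ.proj_apply, Equiv.apply_symm_apply, h.proj_apply, hsp]
  · change Q.proj z'.1.1 = Q.proj z.1.1 at hz
    obtain ⟨k, hk⟩ := hP.exists_act (p := z.1.2) (p' := z'.1.2) (by rw [hproj, hproj, hz])
    refine ⟨k, Subtype.ext (Prod.ext (ψ.toEquiv.injective ?_) hk)⟩
    change ψ.toEquiv z'.1.1 = ψ.toEquiv (Q.act z.1.1 (ext.proj k))
    rw [ψ.map_act, z.2, z'.2, hk, h.map_act]
  · exact fun z k k' hk => hP.act_injective z.1.2 (congrArg (fun z => z.1.2) hk)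
  · intro n a b k ha hb hk
    exact (hP.dSmooth_div (DSmooth.subtypeVal ha.dSmooth).snd (DSmooth.subtypeVal hb.dSmooth).snd
      fun y => congrArg (fun z => z.1.2) (hk y)).isPlot

theorem isLift_gaugePullback [DiffeologicalGroup K'] (hQ : Q.IsPrincipal)
    (h : ext.IsLift Q P p) (ψ : Q.Gauge) : ext.IsLift Q (ext.gaugePullback h ψ) fun z => z.1.1 where
  principal := isPrincipal_gaugePullback hQ h ψ
  smooth := dSmooth_subtypeVal.fst
  proj_apply _ := rfl
  map_act _ _ := rfl

/-- The action of `K'` on the lift `P`, as a biequivariant map `P × g_ψ^* K' → ψ^* P`. -/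
def actBiequivariantMap (hQ : Q.IsPrincipal) (h : ext.IsLift Q P p) (ψ : Q.Gauge) :
    (ext.overTotal h).BiequivariantMap (ext.circleBundle.pullback (hQ.gaugeMap ψ))
      ((ext.overTotal h).pullback ψ.toEquiv) where
  toFun z := ⟨(z.1.2.1.1, P.act z.1.1 z.1.2.1.2), by
    have h1 : p z.1.1 = z.1.2.1.1 := z.2
    have h2 : hQ.gaugeMap ψ z.1.2.1.1 = ext.proj z.1.2.1.2 := z.1.2.2
    -- With `p a = q` and `k` over `g_ψ(q)`, this is `ψ(q) = q g_ψ(q) = p(a k)`.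
    refine Eq.trans ?_ (h.map_act _ _).symm
    rw [hQ.act_gaugeMap ψ, h2, h1]⟩
  smooth n r hr := ⟨hr.2.1, h.principal.smooth_act n (fun y => ((r y).1.1, (r y).1.2.1.2))
    ⟨hr.1, hr.2.2⟩⟩
  proj_apply z := z.2.symm
  map_act_left a b _ t _ := Subtype.ext (Prod.ext rfl (h.act_incl_act a t b.1.2))
  map_act_right a b _ t _ := Subtype.ext <| Prod.ext rfl (P.act_mul a b.1.2 (ext.incl t))

/-! ### Lifts of a gauge transformation and sections of `g_ψ^* K'` -/

section GaugeLift

variable {h : ext.IsLift Q P p} {ψ : Q.Gauge}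

theorem GaugeLift.toEquiv_injective :
    Function.Injective (GaugeLift.toEquiv : ext.GaugeLift h ψ → P.Carrier ≃ P.Carrier) := by
  rintro ⟨e, _, _, _, _⟩ ⟨e', _, _, _, _⟩ (rfl : e = e')
  rfl

theorem GaugeLift.exists_act (χ : ext.GaugeLift h ψ) (a : P.Carrier) :
    ∃ k, χ.toEquiv a = P.act a k :=
  h.principal.exists_act <| by
    rw [← h.proj_apply, χ.covers, ψ.proj_apply, h.proj_apply]

theorem GaugeLift.gaugeMap_eq (hQ : Q.IsPrincipal) (χ : ext.GaugeLift h ψ) {a : P.Carrier} {k : K'}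
    (hk : χ.toEquiv a = P.act a k) : hQ.gaugeMap ψ (p a) = ext.proj k := by
  apply hQ.act_injective (p a)
  rw [← hQ.act_gaugeMap, ← χ.covers, hk, h.map_act]

/-- Points with the same image in `Q` differ by the central circle, which commutes with both `χ` and
`k`. This is why a lift defines a function on `Q` and not merely on `P`. -/
theorem GaugeLift.act_eq (hQ : Q.IsPrincipal)
    (χ : ext.GaugeLift h ψ) {a b : P.Carrier} {k : K'} (hab : p a = p b)
    (hk : χ.toEquiv a = P.act a k) : χ.toEquiv b = P.act b k := by
  obtain ⟨t, rfl⟩ := h.exists_act_incl hQ hab.symm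
  refine (χ.map_act a t).trans ?_
  rw [hk]
  exact (h.act_incl_act a t k).symm

/-- The section of `g_ψ^* K'` determined by a lift of `ψ`. -/
theorem GaugeLift.exists_section [DiffeologicalGroup K] [DiffeologicalGroup K'] (hQ : Q.IsPrincipal)
    (χ : ext.GaugeLift h ψ) :
    ∃ s : (ext.circleBundle.pullback (hQ.gaugeMap ψ)).SmoothSection,
      ∀ a, χ.toEquiv a = P.act a (ext.sectionValue s (p a)) := by
  have hT := isPrincipal_overTotal hQ h
  -- `σ` is only a set-theoretic section. Smoothness of `k` is checked afterwards, by dividing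
  -- `χ(s)` by `s` for smooth local sections `s` of `P → Q`.
  choose σ hσ using hT.surjective_proj
  choose k hk using fun q => χ.exists_act (σ q)
  change ∀ q, p (σ q) = q at hσ
  have hk' : ∀ a, χ.toEquiv a = P.act a (k (p a)) := fun a => χ.act_eq hQ (hσ (p a)) (hk _)
  have hks : DSmooth k := by
    refine dSmooth_of_locally fun q => ?_
    obtain ⟨U, hU, hxU, s, hs, hsp⟩ := hT.exists_localSection q
    refine ⟨U, hU, hxU, h.principal.dSmooth_div hs (χ.smooth.comp hs) fun y => ?_⟩
    have := hk' (s y)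
    rwa [show p (s y) = y from hsp y] at this
  have hkg : ∀ q, hQ.gaugeMap ψ q = ext.proj (k q) := fun q => by
    have := χ.gaugeMap_eq hQ (hk q)
    rwa [hσ] at this
  exact ⟨⟨fun q => ⟨(q, k q), hkg q⟩, (dSmooth_id'.prodMk hks).subtypeMk hkg, fun q => rfl⟩, hk'⟩

theorem proj_sectionValue {Y : Type*} [DiffeologicalSpace Y] {g : Y → K}
    (s : (ext.circleBundle.pullback g).SmoothSection) (y : Y) :
    ext.proj (ext.sectionValue s y) = g y := by
  have h1 : g (s.toFun y).1.1 = ext.proj (ext.sectionValue s y) := (s.toFun y).2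
  rw [← h1, show (s.toFun y).1.1 = y from s.proj_apply y]

theorem dSmooth_sectionValue {Y : Type*} [DiffeologicalSpace Y] {g : Y → K}
    (s : (ext.circleBundle.pullback g).SmoothSection) : DSmooth (ext.sectionValue s) :=
  s.smooth.subtypeVal.snd

theorem sectionValue_injective {Y : Type*} [DiffeologicalSpace Y] {g : Y → K} :
    Function.Injective
      (ext.sectionValue : (ext.circleBundle.pullback g).SmoothSection → Y → K') := by
  rintro ⟨s, hs, hs'⟩ ⟨r, hr, hr'⟩ hsr
  obtain rfl : s = r := funext fun y =>
    Subtype.ext (Prod.ext ((hs' y).trans (hr' y).symm) (congrFun hsr y))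
  rfl

/-- The lift of `ψ` determined by a section of `g_ψ^* K'`. -/
noncomputable def gaugeLiftOfSection [DiffeologicalGroup K'] (hQ : Q.IsPrincipal) (h : ext.IsLift Q P p)
    (s : (ext.circleBundle.pullback (hQ.gaugeMap ψ)).SmoothSection) : ext.GaugeLift h ψ :=
  have hcov : ∀ a, p (P.act a (ext.sectionValue s (p a))) = ψ.toEquiv (p a) := fun a => by
    rw [h.map_act, proj_sectionValue, ← hQ.act_gaugeMap]
  have hinv : ∀ b, p (P.act b (ext.sectionValue s (ψ.toEquiv.symm (p b)))⁻¹) =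
      ψ.toEquiv.symm (p b) := fun b => by
    have := hQ.act_gaugeMap ψ (ψ.toEquiv.symm (p b))
    rw [Equiv.apply_symm_apply] at this
    rw [h.map_act, map_inv, proj_sectionValue]
    nth_rewrite 1 [this]
    rw [Q.act_act_inv]
  { toEquiv :=
      { toFun := fun a => P.act a (ext.sectionValue s (p a))
        -- The preimage of `b` lies over `ψ⁻¹(p b)`, so the value of `s` to be undone is the one at
        -- that point.
        invFun := fun b => P.act b (ext.sectionValue s (ψ.toEquiv.symm (p b)))⁻¹
        left_inv := fun a => by
          dsimp only
          rw [hcov, Equiv.symm_apply_apply, P.act_act_inv]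
        right_inv := fun b => by
          dsimp only
          rw [hinv, P.act_inv_act] }
    smooth := h.principal.dSmooth_act dSmooth_id ((dSmooth_sectionValue s).comp h.smooth)
    smooth_symm := h.principal.dSmooth_act dSmooth_id (DiffeologicalGroup.dSmooth_inv
      ((dSmooth_sectionValue s).comp (ψ.smooth_symm.comp h.smooth)))
    covers := hcov
    map_act := fun a t => by
      have hp : p ((ext.overTotal h).act a t) = p a := (ext.overTotal h).proj_act a t
      change P.act ((ext.overTotal h).act a t) (ext.sectionValue s (p ((ext.overTotal h).act a t))) =
        P.act (P.act a (ext.sectionValue s (p a))) (ext.incl t)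
      rw [hp]
      exact h.act_incl_act a t _ }

/-- Lifts of a gauge transformation `ψ` are the same as sections of `g_ψ^* K'`. -/
noncomputable def gaugeLiftEquiv [DiffeologicalGroup K] [DiffeologicalGroup K']
    (hQ : Q.IsPrincipal) (h : ext.IsLift Q P p) (ψ : Q.Gauge) :
    ext.GaugeLift h ψ ≃ (ext.circleBundle.pullback (hQ.gaugeMap ψ)).SmoothSection where
  toFun χ := (χ.exists_section hQ).choose
  invFun s := gaugeLiftOfSection hQ h s
  left_inv χ := by
    have hχ := (χ.exists_section hQ).choose_spec
    exact GaugeLift.toEquiv_injective (Equiv.ext fun a => (hχ a).symm)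
  right_inv s := by
    have hs := ((gaugeLiftOfSection hQ h s).exists_section hQ).choose_spec
    refine sectionValue_injective (funext fun q => ?_)
    obtain ⟨a, rfl⟩ := (isPrincipal_overTotal hQ h).surjective_proj q
    exact h.principal.act_injective a (hs a).symm

theorem toEquiv_eq_act_gaugeLiftEquiv [DiffeologicalGroup K] [DiffeologicalGroup K']
    (hQ : Q.IsPrincipal) (χ : ext.GaugeLift h ψ) (a : P.Carrier) :
    χ.toEquiv a = P.act a (ext.sectionValue (gaugeLiftEquiv hQ h ψ χ) (p a)) :=
  (χ.exists_section hQ).choose_spec a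

/-- A lift of `ψ` is a gauge transformation iff the corresponding section is equivariant. -/
theorem map_act_iff_sectionValue_act [DiffeologicalGroup K] [DiffeologicalGroup K']
    (hQ : Q.IsPrincipal) (χ : ext.GaugeLift h ψ) :
    (∀ a k, χ.toEquiv (P.act a k) = P.act (χ.toEquiv a) k) ↔
      ∀ q k, ext.sectionValue (gaugeLiftEquiv hQ h ψ χ) (Q.act q (ext.proj k)) =
        k⁻¹ * ext.sectionValue (gaugeLiftEquiv hQ h ψ χ) q * k := by
  -- The two sides are `a k s(p(a) [k])` and `a s(p(a)) k`, where `[k]` is the image of `k` in `K`;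
  -- freeness on `P` cancels `a`.
  have key : ∀ a k, χ.toEquiv (P.act a k) = P.act (χ.toEquiv a) k ↔
      ext.sectionValue (gaugeLiftEquiv hQ h ψ χ) (Q.act (p a) (ext.proj k)) =
        k⁻¹ * ext.sectionValue (gaugeLiftEquiv hQ h ψ χ) (p a) * k := fun a k => by
    rw [toEquiv_eq_act_gaugeLiftEquiv hQ χ (P.act a k), toEquiv_eq_act_gaugeLiftEquiv hQ χ a,
      h.map_act, ← P.act_mul, ← P.act_mul, (h.principal.act_injective a).eq_iff, mul_assoc,
      eq_inv_mul_iff_mul_eq]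
  refine ⟨fun H q k => ?_, fun H a k => (key a k).2 (H _ _)⟩
  obtain ⟨a, rfl⟩ := (isPrincipal_overTotal hQ h).surjective_proj q
  exact (key a k).1 (H a k)

end GaugeLift

end CentralExtension

theorem mainTheorem8
    {E : Type*} [NormedAddCommGroup E] [NormedSpace ℝ E] [FiniteDimensional ℝ E]
    {G : Type*} [TopologicalSpace G] [ChartedSpace E G] [Group G] [LieGroup 𝓘(ℝ, E) ∞ G]
    {K' : Type*} [Group K'] [DiffeologicalSpace K'] [DiffeologicalGroup K']
    (ext : CentralExtension (RotLoopGroup E G) K')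
    {B : Type*} [DiffeologicalSpace B]
    (Q : RightSpace (RotLoopGroup E G) B) (hQ : Q.IsPrincipal)
    (P : RightSpace K' B) (p : P.Carrier → Q.Carrier) (hP : ext.IsLift Q P p)
    (ψ : Q.Gauge) :
    -- the map `g_ψ` is smooth and equivariant for the conjugation action
    (DSmooth (hQ.gaugeMap ψ) ∧
      ∀ q k, hQ.gaugeMap ψ (Q.act q k) = k⁻¹ * hQ.gaugeMap ψ q * k) ∧
    -- the three spaces over `Q` in question are circle bundles
    (ext.overTotal hP).IsPrincipal ∧
    (ext.circleBundle.pullback (hQ.gaugeMap ψ)).IsPrincipal ∧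
    ((ext.overTotal hP).pullback ψ.toEquiv).IsPrincipal ∧
    -- and so their associated complex lines are line bundles
    (ext.overTotal hP).line.IsLineBundle ∧
    (ext.circleBundle.pullback (hQ.gaugeMap ψ)).line.IsLineBundle ∧
    ((ext.overTotal hP).pullback ψ.toEquiv).line.IsLineBundle ∧
    -- `ψ` changes the lift `P` into the lift `ψ^* P`
    ext.IsLift Q (ext.gaugePullback hP ψ) (fun z => z.1.1) ∧
    -- which is `P ⊗ g_ψ^* K'`, as circle bundles and as complex line bundles over `Q`
    Nonempty (((ext.overTotal hP).pullback ψ.toEquiv).Iso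
      ((ext.overTotal hP).tensor (ext.circleBundle.pullback (hQ.gaugeMap ψ)))) ∧
    Nonempty (((ext.overTotal hP).pullback ψ.toEquiv).line.Iso
      ((ext.overTotal hP).line.tensor (ext.circleBundle.pullback (hQ.gaugeMap ψ)).line)) ∧
    -- lifts of `ψ` to `P` are the same as sections of `g_ψ^* K'`, and the lifts that are gauge
    -- transformations of `P` are the same as the equivariant sections
    ∃ e : ext.GaugeLift hP ψ ≃ (ext.circleBundle.pullback (hQ.gaugeMap ψ)).SmoothSection,
      (∀ χ a, χ.toEquiv a = P.act a (ext.sectionValue (e χ) (p a))) ∧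
      ∀ χ, (∀ a k, χ.toEquiv (P.act a k) = P.act (χ.toEquiv a) k) ↔
        ∀ q k, ext.sectionValue (e χ) (Q.act q (ext.proj k)) =
          k⁻¹ * ext.sectionValue (e χ) q * k := by
  have hT := CentralExtension.isPrincipal_overTotal hQ hP
  have hg := ext.isPrincipal_circleBundle.pullback (hQ.dSmooth_gaugeMap ψ)
  have hψ := hT.pullback ψ.smooth
  have m := CentralExtension.actBiequivariantMap hQ hP ψ
  exact ⟨⟨hQ.dSmooth_gaugeMap ψ, hQ.gaugeMap_act ψ⟩, hT, hg, hψ, hT.isLineBundle_line,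
    hg.isLineBundle_line, hψ.isLineBundle_line, CentralExtension.isLift_gaugePullback hQ hP ψ,
    m.nonempty_iso_tensor hT hg hψ, m.nonempty_line_iso_tensor hT hg hψ,
    CentralExtension.gaugeLiftEquiv hQ hP ψ,
    CentralExtension.toEquiv_eq_act_gaugeLiftEquiv hQ,
    CentralExtension.map_act_iff_sectionValue_act hQ⟩
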